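/- **Theorem (Euler–Poincaré–Herglotz with symmetry breaking).** Let $G$ be a finite-dimensional real Lie group with Lie algebra $\mathfrak g=T_eG$ (bracket of left-invariant vector fields), $\mathcal L_g$ left translation, $X$ a finite-dimensional real vector space, $\rho:G\to \mathrm{GL}(X)$ a smooth representation, and $\rho^*_g=\rho(g^{-1})^*$ the induced representation on $X^*$. Let $\rho'_\xi$ be the infinitesimal representation of $\mathfrak g$ on $X$ and $\rho'^*_\xi$ that on $X^*$, so $\langle\rho'^*_\xi\alpha,x\rangle=-\langle\alpha,\rho'_\xi x\rangle$. Let $\xi_X$ be the infinitesimal generator of the action of $G$ on $X$ and $\mathbf J_X:X\times X^*\to\mathfrak g^*$, $\langle \mathbf J_X(x,\alpha),\xi\rangle=\langle\alpha,\xi_X(x)\rangle$. Let $L_{\mathrm{ext}}:TG\times\mathbb R\times X^*\to\mathbb R$ be smooth with $$L_{\mathrm{ext}}(T_k\mathcal L_g(v_k),z,\rho^*_g\alpha)=L_{\mathrm{ext}}(v_k,z,\alpha)\qquad(g,k\in G,\ v_k\in T_kG,\ z\in\mathbb R,\ \alpha\in X^*),$$ and put $\ell_{\mathrm{ext}}(\xi,z,\alpha)=L_{\mathrm{ext}}(e,\xi,z,\alpha)$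 on $\mathfrak g\times\mathbb R\times X^*$. Fix $\alpha_0\in X^*$ and put $L_{\alpha_0}=L_{\mathrm{ext}}(\cdot,\cdot,\alpha_0):TG\times\mathbb R\to\mathbb R$. Let $h>0$, let $g:[0,h]\to G$ and $z:[0,h]\to\mathbb R$ be smooth curves, and put $\xi(t)=T_{g(t)}\mathcal L_{g(t)^{-1}}\dot g(t)$ and $\alpha(t)=\rho^*_{g(t)^{-1}}\alpha_0$. Then the following are equivalent. 1. (Herglotz principle) $\dot z=L_{\alpha_0}(g,\dot g,z)$ on $[0,h]$, and for every smooth variation $c(t,s)$, $t\in[0,h]$, $|s|<\varepsilon$, with $c(t,0)=g(t)$, $c(0,s)=g(0)$, $c(h,s)=g(h)$, for which the solutions $z(\cdot,s)$ of $\partial_t z=L_{\alpha_0}(c,\partial_tc,z)$, $z(0,s)=z(0)$, exist on $[0,h]$ for all $|s|<\varepsilon$ (which holds after shrinking $\varepsilon$), $$\frac{d}{ds}\Big|_{s=0}\int_0^hL_{\alpha_0}(c,\partial_tc,z(t,s))\,dt=0.$$ 2. $(g,z)$ satisfies the Herglotz equations for $L_{\alpha_0}$ on $[0,h]$: in all local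 coordinates $(q^i)$ of $G$, with $L=L_{\alpha_0}$, $$\frac{d}{dt}\frac{\partial L}{\partial\dot q^i}=\frac{\partial L}{\partial q^i}+\frac{\partial L}{\partial \dot q^i}\frac{\partial L}{\partial z},\qquad \dot z=L.$$ Equivalently, in the left trivialization $L(g,\xi,z):=L_{\alpha_0}(g,T_e\mathcal L_g\xi,z)$, $$\frac{d}{dt}\frac{\delta L}{\delta\xi}=\mathrm{ad}^*_\xi\frac{\delta L}{\delta\xi}+T_e^*\mathcal L_g\Big(\frac{\delta L}{\delta g}\Big)+\frac{\delta L}{\delta\xi}\frac{\partial L}{\partial z},\qquad \dot g=T_e\mathcal L_g\xi,\qquad \dot z=L.$$ 3. (Reduced constrained principle) $\dot z=\ell_{\mathrm{ext}}(\xi,z,\alpha)$ on $[0,h]$, and for all smooth variations $\xi(t,s)$, $\alpha(t,s)$ of $\xi(t)$, $\alpha(t)$ whose derivatives at $s=0$ have the form $$\delta\xi=\dot\eta+\mathrm{ad}_\xi\eta,\qquad \delta\alpha=-\rho'^*_\eta\alpha,$$ with $\eta:[0,h]\to\mathfrak g$ smooth and $\eta(0)=\eta(h)=0$, and for which the solutions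 $z(\cdot,s)$ of $\partial_tz=\ell_{\mathrm{ext}}(\xi(t,s),z,\alpha(t,s))$, $z(0,s)=z(0)$, exist on $[0,h]$ for all $|s|<\varepsilon$ (which holds after shrinking $\varepsilon$), one has $$\frac{d}{ds}\Big|_{s=0}\int_0^h\ell_{\mathrm{ext}}(\xi(t,s),z(t,s),\alpha(t,s))\,dt=0.$$ 4. $\xi,z,\alpha$ satisfy on $[0,h]$ the Euler–Poincaré–Herglotz equations $$\frac{d}{dt}\frac{\delta\ell_{\mathrm{ext}}}{\delta\xi}=\mathrm{ad}^*_\xi\frac{\delta\ell_{\mathrm{ext}}}{\delta\xi}+\mathbf J_X\Big(\frac{\delta\ell_{\mathrm{ext}}}{\delta\alpha},\alpha\Big)+\frac{\delta\ell_{\mathrm{ext}}}{\delta\xi}\frac{\partial\ell_{\mathrm{ext}}}{\partial z},$$ $$\dot\alpha=-\rho'^*_\xi\alpha,\qquad \alpha(0)=\rho^*_{g(0)^{-1}}\alpha_0,\qquad \dot z=\ell_{\mathrm{ext}}.$$ -/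

import Mathlib

open Set
open scoped Manifold ContDiff

namespace HerglotzReduction

noncomputable section

/-! Throughout, `G` is a finite-dimensional real Lie group modelled on `E`.  The Lie algebra
`𝔤 = T₁G` is Mathlib's `GroupLieAlgebra 𝓘(ℝ, E) G = TangentSpace 𝓘(ℝ, E) (1 : G)`, whose underlying
normed space is `E`; since `TangentSpace` carries no norm, elements of `𝔤` are written with type `E`.
`𝔤*` is `StrongDual ℝ E`, and `X*` is `StrongDual ℝ X`. -/

section LieGroupNotions

variable {E : Type*} [NormedAddCommGroup E] [NormedSpace ℝ E]
  {G : Type*} [TopologicalSpace G] [ChartedSpace E G] [Group G]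

/-- The Lie bracket of `𝔤 = T₁G` (that of left-invariant vector fields). -/
def bracket (G : Type*) [TopologicalSpace G] [ChartedSpace E G] [Group G] (ξ η : E) : E :=
  (⁅(show GroupLieAlgebra 𝓘(ℝ, E) G from ξ), (show GroupLieAlgebra 𝓘(ℝ, E) G from η)⁆ :
    GroupLieAlgebra 𝓘(ℝ, E) G)

/-- `ad_ξ : 𝔤 → 𝔤`, `ad_ξ η = [ξ, η]`.  Its dual `ad*_ξ` is `μ ↦ μ ∘L ad G ξ`. -/
def ad (G : Type*) [TopologicalSpace G] [ChartedSpace E G] [Group G] [FiniteDimensional ℝ E]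
    [LieGroup 𝓘(ℝ, E) ∞ G] (ξ : E) : E →L[ℝ] E :=
  haveI : CompleteSpace E := FiniteDimensional.complete ℝ E
  haveI : LieGroup 𝓘(ℝ, E) (minSmoothness ℝ 3) G :=
    LieGroup.of_le (n := ∞) (by
      rw [minSmoothness_of_isRCLikeNormedField]; exact WithTop.coe_le_coe.2 (le_top (a := (3 : ℕ∞))))
  LinearMap.toContinuousLinearMap
    { toFun := fun η => bracket G ξ η
      map_add' := fun η₁ η₂ =>
        lie_add (L := GroupLieAlgebra 𝓘(ℝ, E) G) (M := GroupLieAlgebra 𝓘(ℝ, E) G) ξ η₁ η₂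
      map_smul' := fun c η =>
        lie_smul (R := ℝ) (L := GroupLieAlgebra 𝓘(ℝ, E) G) (M := GroupLieAlgebra 𝓘(ℝ, E) G)
          c ξ η }

/-- The tangent map `T₁ℒ_g : 𝔤 → T_gG` of left translation by `g`. -/
def leftTangent (g : G) : E →L[ℝ] TangentSpace 𝓘(ℝ, E) g :=
  let A : TangentSpace 𝓘(ℝ, E) (1 : G) →L[ℝ] TangentSpace 𝓘(ℝ, E) (g * 1) :=
    mfderiv 𝓘(ℝ, E) 𝓘(ℝ, E) (fun x : G => g * x) 1
  A

/-- The tangent lift `Tℒ_g : TG → TG` of left translation by `g`. -/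
def tangentLift (g : G) (v : TangentBundle 𝓘(ℝ, E) G) : TangentBundle 𝓘(ℝ, E) G :=
  tangentMap 𝓘(ℝ, E) 𝓘(ℝ, E) (fun x : G => g * x) v

/-- The velocity `ġ(t) ∈ T_{g(t)}G` of a curve defined on `[0, h]` (one-sided at the endpoints). -/
def velocity (h : ℝ) (g : ℝ → G) (t : ℝ) : TangentSpace 𝓘(ℝ, E) (g t) :=
  mfderivWithin 𝓘(ℝ, ℝ) 𝓘(ℝ, E) g (Icc 0 h) t (1 : ℝ)

/-- The curve `(g(t), ġ(t))` in `TG`. -/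
def tangentCurve (h : ℝ) (g : ℝ → G) (t : ℝ) : TangentBundle 𝓘(ℝ, E) G :=
  ⟨g t, velocity h g t⟩

/-- The left-trivialized velocity `ξ(t) = T_{g(t)}ℒ_{g(t)⁻¹}(ġ(t)) ∈ 𝔤`. -/
def bodyVelocity (h : ℝ) (g : ℝ → G) (t : ℝ) : E :=
  let A : TangentSpace 𝓘(ℝ, E) (g t) →L[ℝ] TangentSpace 𝓘(ℝ, E) ((g t)⁻¹ * g t) :=
    mfderiv 𝓘(ℝ, E) 𝓘(ℝ, E) (fun x : G => (g t)⁻¹ * x) (g t)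
  A (velocity h g t)

/-! ### The Herglotz principle and Herglotz' equations for `L : TG × ℝ → ℝ` -/

/-- The Herglotz variational principle
`δ ∫₀ʰ L(g, ġ, z) dt = 0`, `ż = L(g, ġ, z)`, for variations of `g` with fixed endpoints:
for every smooth family `c(t, s)` of curves with `c(t, 0) = g(t)`, `c(0, s) = g(0)`,
`c(h, s) = g(h)`, the action `s ↦ ∫₀ʰ L(c, ∂c/∂t, z(·, s)) dt` has vanishing derivative at `s = 0`,
where `z(·, s)` solves `∂z/∂t = L(c, ∂c/∂t, z)` on `[0, h]` with `z(0, s) = z(0)`. -/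
def HerglotzPrinciple (L : TangentBundle 𝓘(ℝ, E) G → ℝ → ℝ) (h : ℝ) (g : ℝ → G) (z : ℝ → ℝ) :
    Prop :=
  (∀ t ∈ Icc 0 h, HasDerivWithinAt z (L (tangentCurve h g t) (z t)) (Icc 0 h) t) ∧
  ∀ (ε : ℝ) (c : ℝ × ℝ → G) (Z : ℝ × ℝ → ℝ), 0 < ε →
    ContMDiffOn 𝓘(ℝ, ℝ × ℝ) 𝓘(ℝ, E) ∞ c (Icc 0 h ×ˢ Ioo (-ε) ε) →
    (∀ t ∈ Icc 0 h, c (t, 0) = g t) →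
    (∀ s ∈ Ioo (-ε) ε, c (0, s) = g 0 ∧ c (h, s) = g h) →
    (∀ s ∈ Ioo (-ε) ε, Z (0, s) = z 0 ∧ ∀ t ∈ Icc 0 h,
      HasDerivWithinAt (fun τ => Z (τ, s))
        (L (tangentCurve h (fun τ => c (τ, s)) t) (Z (t, s))) (Icc 0 h) t) →
    HasDerivAt
      (fun s => ∫ t in (0 : ℝ)..h, L (tangentCurve h (fun τ => c (τ, s)) t) (Z (t, s))) 0 0

/-- The expression `L(q, v, z)` of `L` in the coordinates `(q, v, z)` on `TG × ℝ` induced by a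
chart `e` of `G`. -/
def chartLagrangian (L : TangentBundle 𝓘(ℝ, E) G → ℝ → ℝ) (e : OpenPartialHomeomorph G E)
    (q v : E) (z : ℝ) : ℝ :=
  L ⟨e.symm q, mfderiv 𝓘(ℝ, E) 𝓘(ℝ, E) e.symm q v⟩ z

/-- The Herglotz equations for `L` in every smooth chart `e` of `G`: with `q = e ∘ g`,
`d/dt (∂L/∂q̇) = ∂L/∂q + (∂L/∂z) ∂L/∂q̇` whenever `g(t)` lies in the chart domain,
and `ż = L(g, ġ, z)`. -/
def HerglotzEquations (L : TangentBundle 𝓘(ℝ, E) G → ℝ → ℝ) (h : ℝ) (g : ℝ → G) (z : ℝ → ℝ) :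
    Prop :=
  (∀ e ∈ IsManifold.maximalAtlas 𝓘(ℝ, E) ∞ G, ∀ t ∈ Icc 0 h, g t ∈ e.source →
    let q : ℝ → E := fun τ => e (g τ)
    let q' : ℝ → E := derivWithin q (Icc 0 h)
    let p : ℝ → StrongDual ℝ E :=
      fun τ => fderiv ℝ (fun v => chartLagrangian L e (q τ) v (z τ)) (q' τ)
    HasDerivWithinAt p
      (fderiv ℝ (fun x => chartLagrangian L e x (q' t) (z t)) (q t)
        + deriv (fun w => chartLagrangian L e (q t) (q' t) w) (z t) • p t) (Icc 0 h) t) ∧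
  ∀ t ∈ Icc 0 h, HasDerivWithinAt z (L (tangentCurve h g t) (z t)) (Icc 0 h) t

/-- The left trivialization `(g, ξ, z) ↦ L(g, T₁ℒ_g ξ, z)` of `L`. -/
def trivializedLagrangian (L : TangentBundle 𝓘(ℝ, E) G → ℝ → ℝ) (g : G) (ξ : E) (z : ℝ) : ℝ :=
  L ⟨g, leftTangent g ξ⟩ z

/-- The Herglotz equations on a Lie group in left-trivialized form, with `ξ = T_gℒ_{g⁻¹} ġ`:
`d/dt (δL/δξ) = ad*_ξ (δL/δξ) + T₁*ℒ_g (δL/δg) + (∂L/∂z) δL/δξ`, `ġ = T₁ℒ_g ξ`, `ż = L`. -/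
def TrivializedHerglotzEquations [FiniteDimensional ℝ E] [LieGroup 𝓘(ℝ, E) ∞ G]
    (L : TangentBundle 𝓘(ℝ, E) G → ℝ → ℝ) (h : ℝ) (g : ℝ → G) (z : ℝ → ℝ) : Prop :=
  let ξ : ℝ → E := bodyVelocity h g
  let p : ℝ → StrongDual ℝ E :=
    fun τ => fderiv ℝ (fun x => trivializedLagrangian L (g τ) x (z τ)) (ξ τ)
  let dg : (t : ℝ) → TangentSpace 𝓘(ℝ, E) (g t) →L[ℝ] ℝ :=
    fun t => mfderiv 𝓘(ℝ, E) 𝓘(ℝ, ℝ) (fun x => trivializedLagrangian L x (ξ t) (z t)) (g t)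
  ∀ t ∈ Icc 0 h,
    HasDerivWithinAt p
      ((p t).comp (ad G (ξ t)) + (dg t).comp (leftTangent (g t))
        + deriv (fun w => trivializedLagrangian L (g t) (ξ t) w) (z t) • p t) (Icc 0 h) t ∧
    velocity h g t = leftTangent (g t) (ξ t) ∧
    HasDerivWithinAt z (trivializedLagrangian L (g t) (ξ t) (z t)) (Icc 0 h) t

end LieGroupNotions

/-! ### Representations, the momentum map, and the reduced system -/

section Reduced

variable {E : Type*} [NormedAddCommGroup E] [NormedSpace ℝ E]
  {G : Type*} [TopologicalSpace G] [ChartedSpace E G] [Group G]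
  {X : Type*} [NormedAddCommGroup X] [NormedSpace ℝ X]

/-- The adjoint representation `ρ*_g α = α ∘ ρ(g⁻¹)` of `G` on `X*`. -/
def dualRep (ρ : G →* (X →L[ℝ] X)) (g : G) (α : StrongDual ℝ X) : StrongDual ℝ X :=
  α.comp (ρ g⁻¹)

/-- The infinitesimal representation `ρ' : 𝔤 → 𝔤𝔩(X)`, the tangent map of `ρ` at the identity. -/
def infRep (ρ : G →* (X →L[ℝ] X)) : E →L[ℝ] (X →L[ℝ] X) :=
  let A : TangentSpace 𝓘(ℝ, E) (1 : G) →L[ℝ] TangentSpace 𝓘(ℝ, X →L[ℝ] X) (ρ 1) :=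
    mfderiv 𝓘(ℝ, E) 𝓘(ℝ, X →L[ℝ] X) ρ 1
  A

/-- The infinitesimal adjoint representation `ρ'* : 𝔤 → 𝔤𝔩(X*)`,
`⟨ρ'*_ξ α, x⟩ = - ⟨α, ρ'_ξ x⟩`. -/
def infDualRep (ρ : G →* (X →L[ℝ] X)) (ξ : E) (α : StrongDual ℝ X) : StrongDual ℝ X :=
  -(α.comp (infRep ρ ξ))

/-- The infinitesimal generator `ξ ↦ ξ_X(x)` of the action `g • x = ρ(g) x` of `G` on `X`. -/
def infGenerator (ρ : G →* (X →L[ℝ] X)) (x : X) : E →L[ℝ] X :=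
  let A : TangentSpace 𝓘(ℝ, E) (1 : G) →L[ℝ] TangentSpace 𝓘(ℝ, X) (ρ 1 x) :=
    mfderiv 𝓘(ℝ, E) 𝓘(ℝ, X) (fun g : G => ρ g x) 1
  A

/-- The momentum map `J_X : X × X* → 𝔤*`, `⟨J_X(x, α), ξ⟩ = ⟨α, ξ_X(x)⟩`. -/
def momentumMap (ρ : G →* (X →L[ℝ] X)) (x : X) (α : StrongDual ℝ X) : StrongDual ℝ E :=
  α.comp (infGenerator ρ x)

/-- The functional derivative `δf/δα ∈ X` of `f : X* → ℝ` at `α`, i.e. the differential of `f`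
at `α` seen as an element of `X** ≃ X`. -/
def dualGradient [FiniteDimensional ℝ X] (f : StrongDual ℝ X → ℝ) (α : StrongDual ℝ X) : X :=
  (Module.evalEquiv ℝ X).symm
    ((fderiv ℝ f α).toLinearMap ∘ₗ
      (LinearMap.toContinuousLinearMap : (X →ₗ[ℝ] ℝ) ≃ₗ[ℝ] (X →L[ℝ] ℝ)).toLinearMap)

lemma apply_dualGradient [FiniteDimensional ℝ X] (f : StrongDual ℝ X → ℝ)
    (α u : StrongDual ℝ X) : u (dualGradient f α) = fderiv ℝ f α u := by
  have := Module.apply_evalEquiv_symm_apply (R := ℝ) (M := X) u.toLinearMap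
    ((fderiv ℝ f α).toLinearMap ∘ₗ
      (LinearMap.toContinuousLinearMap : (X →ₗ[ℝ] ℝ) ≃ₗ[ℝ] (X →L[ℝ] ℝ)).toLinearMap)
  exact this

/-- The reduced extended Lagrangian `ℓ_ext(ξ, z, α) = L_ext(1, ξ, z, α)` on `𝔤 × ℝ × X*`. -/
def reducedLagrangian (L : TangentBundle 𝓘(ℝ, E) G → ℝ → StrongDual ℝ X → ℝ)
    (ξ : E) (z : ℝ) (α : StrongDual ℝ X) : ℝ :=
  L ⟨(1 : G), ξ⟩ z α

/-- The reduced constrained variational principle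
`δ ∫₀ʰ ℓ(ξ, z, α) dt = 0`, `ż = ℓ(ξ, z, α)`, for smooth variations `ξ(t, s)`, `α(t, s)` of the form
`δξ = η̇ + ad_ξ η`, `δα = -ρ'*_η α`, where `η` is a smooth curve in `𝔤` vanishing at `0` and `h`;
here `z(·, s)` solves `∂z/∂t = ℓ(ξ(t, s), z, α(t, s))` on `[0, h]` with `z(0, s) = z(0)`. -/
def ReducedPrinciple [FiniteDimensional ℝ E] [LieGroup 𝓘(ℝ, E) ∞ G] (ρ : G →* (X →L[ℝ] X))
    (ℓ : E → ℝ → StrongDual ℝ X → ℝ) (h : ℝ) (ξ : ℝ → E) (z : ℝ → ℝ) (α : ℝ → StrongDual ℝ X) :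
    Prop :=
  (∀ t ∈ Icc 0 h, HasDerivWithinAt z (ℓ (ξ t) (z t) (α t)) (Icc 0 h) t) ∧
  ∀ (ε : ℝ) (Ξ : ℝ × ℝ → E) (A : ℝ × ℝ → StrongDual ℝ X) (Z : ℝ × ℝ → ℝ) (η : ℝ → E), 0 < ε →
    ContDiffOn ℝ ∞ Ξ (Icc 0 h ×ˢ Ioo (-ε) ε) →
    ContDiffOn ℝ ∞ A (Icc 0 h ×ˢ Ioo (-ε) ε) →
    ContDiffOn ℝ ∞ η (Icc 0 h) → η 0 = 0 → η h = 0 →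
    (∀ t ∈ Icc 0 h, Ξ (t, 0) = ξ t ∧ A (t, 0) = α t) →
    (∀ t ∈ Icc 0 h,
      HasDerivAt (fun s => Ξ (t, s)) (derivWithin η (Icc 0 h) t + ad G (ξ t) (η t)) 0 ∧
      HasDerivAt (fun s => A (t, s)) (-infDualRep ρ (η t) (α t)) 0) →
    (∀ s ∈ Ioo (-ε) ε, Z (0, s) = z 0 ∧ ∀ t ∈ Icc 0 h,
      HasDerivWithinAt (fun τ => Z (τ, s)) (ℓ (Ξ (t, s)) (Z (t, s)) (A (t, s))) (Icc 0 h) t) →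
    HasDerivAt (fun s => ∫ t in (0 : ℝ)..h, ℓ (Ξ (t, s)) (Z (t, s)) (A (t, s))) 0 0

/-- The semidirect-product Euler-Poincaré-Herglotz equations
`d/dt (δℓ/δξ) = ad*_ξ (δℓ/δξ) + J_X(δℓ/δα, α) + (∂ℓ/∂z) δℓ/δξ`, `α̇ = -ρ'*_ξ α`,
`α(0) = ρ*_{g₀⁻¹} α₀`, `ż = ℓ`. -/
def EulerPoincareHerglotzEquations [FiniteDimensional ℝ E] [LieGroup 𝓘(ℝ, E) ∞ G]
    [FiniteDimensional ℝ X] (ρ : G →* (X →L[ℝ] X)) (ℓ : E → ℝ → StrongDual ℝ X → ℝ) (h : ℝ)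
    (g₀ : G) (α₀ : StrongDual ℝ X) (ξ : ℝ → E) (z : ℝ → ℝ) (α : ℝ → StrongDual ℝ X) : Prop :=
  let p : ℝ → StrongDual ℝ E := fun τ => fderiv ℝ (fun x => ℓ x (z τ) (α τ)) (ξ τ)
  α 0 = dualRep ρ g₀⁻¹ α₀ ∧
  ∀ t ∈ Icc 0 h,
    HasDerivWithinAt p
      ((p t).comp (ad G (ξ t))
        + momentumMap ρ (dualGradient (fun a => ℓ (ξ t) (z t) a) (α t)) (α t)
        + deriv (fun w => ℓ (ξ t) w (α t)) (z t) • p t) (Icc 0 h) t ∧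
    HasDerivWithinAt α (-infDualRep ρ (ξ t) (α t)) (Icc 0 h) t ∧
    HasDerivWithinAt z (ℓ (ξ t) (z t) (α t)) (Icc 0 h) t

end Reduced

end

end HerglotzReduction

/-! Invariance under left translation by g⁻¹ gives L(g, v, z) = ℓ(ξ, z, α) at the parameter α₀, with
ξ = T_gℒ_{g⁻¹}v and α = α₀ ∘ ρ(g). Hence all five statements can be expressed through ξ, z and α,
and they meet in one system, `MomentumEquations`: with p = ∂ℓ/∂ξ, p' = p ∘ ad_ξ + (∂ℓ/∂α)(α ∘ ρ'_·)
+ (∂ℓ/∂z) p, together with z' = ℓ.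

Analytic half. As z' = ℓ, the action is z(h, s) - z(0), so its s-derivative at 0 is w(h), where w(0)
= 0 and w' = (∂ℓ/∂z) w + p(δξ) + (∂ℓ/∂α)(δα) (`hasDerivAt_solution_family`, `hasDerivAt_action`). If
the momentum equation holds and δξ = η' + ad_ξ η, δα = α ∘ ρ'_η, then w = p(η), which vanishes at h.
Conversely, if w(h) = 0 for every η vanishing at the endpoints, a du Bois-Reymond argument
(`hasDerivWithinAt_momentum_of_forall_variation`) returns the momentum equation.

Geometric half. For a variation c(t, s) the form ω = c*θ packages ξ = ω(∂_t) and η = ω(∂_s). The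
Maurer-Cartan equation (`structure_equation`) evaluated on (∂_t, ∂_s) is precisely δξ = η' + ad_ξ η,
so variations of g with fixed endpoints induce constrained reduced variations. Every η arises in
this way (`exists_variation`), which is why the unreduced principle already implies the momentum
equation.

In a chart, ξ = Λ(q)q' with Λ(q) invertible, and the chart momentum is p ∘ Λ(q). By the structure
equation for Λ, the residual of the Herglotz equation is the residual of the momentum equation
composed with Λ(q) (`chart_momentumEquation_iff`), so the two vanish together. -/

namespace HerglotzReduction

open Filter Topology

/-! ### Scalar differential equations depending on a parameter -/

section ODE

/-- Grönwall's inequality with zero initial value, whose bound is linear in the inhomogeneity κ.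
Linearity is what turns κ = O(|s|) or κ = o(|s|) into estimates of the same order on the solution.
-/
lemma abs_le_of_deriv_bound {h K κ : ℝ} {f f' : ℝ → ℝ} (hK : 0 ≤ K) (hκ : 0 ≤ κ)
    (hf : ∀ t ∈ Icc 0 h, HasDerivWithinAt f (f' t) (Icc 0 h) t) (h0 : f 0 = 0)
    (hb : ∀ t ∈ Icc 0 h, |f' t| ≤ K * |f t| + κ) :
    ∀ t ∈ Icc 0 h, |f t| ≤ κ * gronwallBound 0 K 1 h := by
  intro t ht
  have h1 := norm_le_gronwallBound_of_norm_deriv_right_le (f := f) (f' := f') (δ := 0) (K := K)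
    (ε := κ) (a := 0) (b := h) (fun t ht => (hf t ht).continuousWithinAt)
    (fun x hx => ((hf x (Ico_subset_Icc_self hx)).mono_of_mem_nhdsWithin
      (mem_of_superset (Icc_mem_nhdsGE hx.2) (Icc_subset_Icc_left hx.1))))
    (by simp [h0]) (fun x hx => hb x (Ico_subset_Icc_self hx)) t ht
  have h2 : gronwallBound 0 K κ (t - 0) ≤ gronwallBound 0 K κ h :=
    gronwallBound_mono le_rfl hκ hK (by linarith [ht.2])
  have h3 : gronwallBound 0 K κ h = κ * gronwallBound 0 K 1 h := by
    rcases eq_or_ne K 0 with rfl | hK0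
    · simp [gronwallBound_K0]
    · simp only [gronwallBound_of_K_ne_0 hK0]; ring
  calc |f t| ≤ _ := h1
    _ ≤ _ := h2
    _ = _ := h3

lemma gronwallBound_zero_one_nonneg {K h : ℝ} (hK : 0 ≤ K) (hh : 0 ≤ h) :
    0 ≤ gronwallBound 0 K 1 h := by
  have := gronwallBound_mono (le_refl (0 : ℝ)) zero_le_one hK hh
  rwa [gronwallBound_x0] at this

/-- The domain `[0, h] × (-ε, ε) × ℝ` of a one-parameter family of scalar differential equations. -/
abbrev paramDomain (h ε : ℝ) : Set (ℝ × ℝ × ℝ) := Icc 0 h ×ˢ (Ioo (-ε) ε ×ˢ univ)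

/-- Time runs over a closed interval, so `F` is only differentiable within the domain; its (s,
y)-slices are open, so the partial differential there is a genuine one and remains jointly
continuous up to t = 0 and t = h. -/
lemma exists_slice_fderiv {h ε : ℝ} (hh : 0 < h) {F : ℝ × ℝ × ℝ → ℝ}
    (hF : ContDiffOn ℝ 1 F (paramDomain h ε)) :
    ∃ D : ℝ × ℝ × ℝ → (ℝ × ℝ →L[ℝ] ℝ), ContinuousOn D (paramDomain h ε) ∧
      ∀ t ∈ Icc 0 h, ∀ q ∈ Ioo (-ε) ε ×ˢ (univ : Set ℝ),
        HasFDerivAt (fun q => F (t, q)) (D (t, q)) q := by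
  have hU : UniqueDiffOn ℝ (paramDomain h ε) :=
    (uniqueDiffOn_Icc hh).prod ((isOpen_Ioo.prod isOpen_univ).uniqueDiffOn)
  refine ⟨fun p => (fderivWithin ℝ F (paramDomain h ε) p).comp
    (ContinuousLinearMap.inr ℝ ℝ (ℝ × ℝ)), ?_, ?_⟩
  · exact (hF.continuousOn_fderivWithin hU le_rfl).clm_comp continuousOn_const
  · intro t ht q hq
    have h1 := ((hF.differentiableOn one_ne_zero) (t, q) ⟨ht, hq⟩).hasFDerivWithinAt
    have h2 : HasFDerivWithinAt (fun q : ℝ × ℝ => (t, q)) (ContinuousLinearMap.inr ℝ ℝ (ℝ × ℝ))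
        (Ioo (-ε) ε ×ˢ (univ : Set ℝ)) q := (hasFDerivAt_prodMk_right t q).hasFDerivWithinAt
    exact (h1.comp q h2 (fun y hy => ⟨ht, hy⟩)).hasFDerivAt
      ((isOpen_Ioo.prod isOpen_univ).mem_nhds hq)

/-- The tube is the image of a box under the shear (t, s, u) ↦ (t, s, z(t) + u). -/
lemma isCompact_tube {h r : ℝ} {z : ℝ → ℝ} (hz : ContinuousOn z (Icc 0 h)) (R : ℝ) :
    IsCompact {p : ℝ × ℝ × ℝ | p.1 ∈ Icc 0 h ∧ |p.2.1| ≤ r ∧ |p.2.2 - z p.1| ≤ R} := by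
  have h1 : IsCompact (Icc 0 h ×ˢ (Icc (-r) r ×ˢ Icc (-R) R) : Set (ℝ × ℝ × ℝ)) :=
    isCompact_Icc.prod (isCompact_Icc.prod isCompact_Icc)
  have h2 : ContinuousOn (fun p : ℝ × ℝ × ℝ => (p.1, p.2.1, z p.1 + p.2.2))
      (Icc 0 h ×ˢ (Icc (-r) r ×ˢ Icc (-R) R)) := by
    have : ContinuousOn (fun p : ℝ × ℝ × ℝ => z p.1) (Icc 0 h ×ˢ (Icc (-r) r ×ˢ Icc (-R) R)) :=
      hz.comp continuousOn_fst (fun p hp => hp.1)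
    exact continuousOn_fst.prodMk ((continuousOn_fst.comp continuousOn_snd (mapsTo_univ _ _)).prodMk (this.add (continuousOn_snd.comp continuousOn_snd (mapsTo_univ _ _))))
  convert h1.image_of_continuousOn h2 using 1
  ext ⟨t, s, y⟩
  simp only [mem_ofPred_eq, mem_image, mem_prod, Prod.exists, Prod.mk.injEq, abs_le]
  constructor
  · rintro ⟨a, b, c⟩
    exact ⟨t, s, y - z t, ⟨a, b, c⟩, rfl, rfl, by ring⟩
  · rintro ⟨t', s', u, ⟨a, b, c⟩, rfl, rfl, rfl⟩
    exact ⟨a, b, by simpa using c⟩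

/-- Solutions with nearby parameter stay near a given solution, and exist on the same interval. -/
theorem exists_solution_family {h ε : ℝ} (hh : 0 < h) (hε : 0 < ε) {F : ℝ × ℝ × ℝ → ℝ}
    (hF : ContDiffOn ℝ 1 F (paramDomain h ε)) {z : ℝ → ℝ}
    (hz : ∀ t ∈ Icc 0 h, HasDerivWithinAt z (F (t, 0, z t)) (Icc 0 h) t) :
    ∃ δ C : ℝ, 0 < δ ∧ δ < ε ∧ 0 ≤ C ∧ ∃ Z : ℝ × ℝ → ℝ, ∀ s ∈ Ioo (-δ) δ, Z (0, s) = z 0 ∧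
      ∀ t ∈ Icc 0 h, HasDerivWithinAt (fun τ => Z (τ, s)) (F (t, s, Z (t, s))) (Icc 0 h) t ∧
        |Z (t, s) - z t| ≤ C * |s| := by
  obtain ⟨D, hD, hFD⟩ := exists_slice_fderiv hh hF
  have hzc : ContinuousOn z (Icc 0 h) := fun t ht => (hz t ht).continuousWithinAt
  have hK := isCompact_tube (r := ε / 2) hzc 1
  have hsub : {p : ℝ × ℝ × ℝ | p.1 ∈ Icc 0 h ∧ |p.2.1| ≤ ε / 2 ∧ |p.2.2 - z p.1| ≤ 1} ⊆
      paramDomain h ε := by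
    rintro ⟨t, s, y⟩ ⟨h1, h2, -⟩
    have := abs_le.1 h2
    exact ⟨h1, ⟨by simp only at this ⊢; linarith, by simp only at this ⊢; linarith⟩, trivial⟩
  obtain ⟨M₀, hM₀⟩ := hK.exists_bound_of_continuousOn (hD.mono hsub)
  obtain ⟨B₀, hB₀⟩ := hK.exists_bound_of_continuousOn (hF.continuousOn.mono hsub)
  set M := Real.toNNReal M₀
  set B := Real.toNNReal B₀
  have hM : ∀ t ∈ Icc 0 h, ∀ s y, |s| ≤ ε / 2 → |y - z t| ≤ 1 → ‖D (t, s, y)‖ ≤ M :=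
    fun t ht s y hs hy => (hM₀ (t, s, y) ⟨ht, hs, hy⟩).trans (Real.le_coe_toNNReal _)
  have hB : ∀ t ∈ Icc 0 h, ∀ s y, |s| ≤ ε / 2 → |y - z t| ≤ 1 → |F (t, s, y)| ≤ B :=
    fun t ht s y hs hy => (hB₀ (t, s, y) ⟨ht, hs, hy⟩).trans (Real.le_coe_toNNReal _)
  have hLip : ∀ t ∈ Icc 0 h, ∀ q q' : ℝ × ℝ, |q.1| ≤ ε / 2 → |q.2 - z t| ≤ 1 →
      |q'.1| ≤ ε / 2 → |q'.2 - z t| ≤ 1 → |F (t, q') - F (t, q)| ≤ M * ‖q' - q‖ := by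
    intro t ht q q' h1 h2 h3 h4
    have hconv : Convex ℝ (Metric.closedBall (0 : ℝ) (ε / 2) ×ˢ Metric.closedBall (z t) 1) :=
      (convex_closedBall _ _).prod (convex_closedBall _ _)
    refine hconv.norm_image_sub_le_of_norm_hasFDerivWithin_le
      (f := fun q => F (t, q)) (f' := fun q => D (t, q)) (fun q hq => ?_) (fun q hq => ?_)
      (x := q) (y := q') ?_ ?_
    · refine (hFD t ht q ⟨?_, trivial⟩).hasFDerivWithinAt
      have : |q.1| ≤ ε / 2 := by simpa [Real.dist_eq] using hq.1
      rw [abs_le] at this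
      exact ⟨by linarith, by linarith⟩
    · exact hM t ht _ _ (by simpa [Real.dist_eq] using hq.1) (by simpa [Real.dist_eq] using hq.2)
    · exact ⟨by simpa [Real.dist_eq] using h1, by simpa [Real.dist_eq] using h2⟩
    · exact ⟨by simpa [Real.dist_eq] using h3, by simpa [Real.dist_eq] using h4⟩
  -- Truncating y - z(t) to [-1, 1] makes the right-hand side bounded and globally Lipschitz in y,
  -- so Picard-Lindelöf covers all of [0, h] at once; the truncation is removed at the end.
  set cl : ℝ → ℝ := fun u => max (-1) (min 1 u)
  have hcl : ∀ u, |cl u| ≤ 1 := fun u => abs_le.2 ⟨le_max_left _ _, max_le (by norm_num)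
    (min_le_left _ _)⟩
  have hcl1 : ∀ u, |u| ≤ 1 → cl u = u := fun u hu => by
    rw [abs_le] at hu
    simp only [cl]
    rw [min_eq_right hu.2, max_eq_right hu.1]
  have hclLip : LipschitzWith 1 cl := (LipschitzWith.id.const_min 1).const_max (-1)
  set Ft : ℝ → ℝ → ℝ → ℝ := fun s t y => F (t, s, z t + cl (y - z t))
  have hFtLip : ∀ s, |s| ≤ ε / 2 → ∀ t ∈ Icc 0 h, ∀ y y', |Ft s t y - Ft s t y'| ≤ M * |y - y'| := by
    intro s hs t ht y y'
    refine (hLip t ht (s, z t + cl (y' - z t)) (s, z t + cl (y - z t)) hs (by simpa using hcl _) hs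
      (by simpa using hcl _)).trans ?_
    gcongr
    simp only [Prod.mk_sub_mk, sub_self, add_sub_add_left_eq_sub, Prod.norm_mk, norm_zero]
    refine max_le (abs_nonneg _) ?_
    have := hclLip.dist_le_mul (y - z t) (y' - z t)
    simpa [Real.dist_eq] using this
  have hex : ∀ s, |s| ≤ ε / 2 → ∃ ζ : ℝ → ℝ, ζ 0 = z 0 ∧
      ∀ t ∈ Icc 0 h, HasDerivWithinAt ζ (Ft s t (ζ t)) (Icc 0 h) t := by
    intro s hs
    have hPL : IsPicardLindelof (Ft s) (tmin := 0) (tmax := h) ⟨0, le_rfl, hh.le⟩ (z 0)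
        (B * Real.toNNReal h) 0 B M :=
      { lipschitzOnWith := fun t ht => LipschitzOnWith.of_dist_le_mul fun y _ y' _ => by
          simpa [Real.dist_eq] using hFtLip s hs t ht y y'
        continuousOn := fun y _ => by
          have : ContinuousOn (fun t => (t, s, z t + cl (y - z t))) (Icc 0 h) := by
            have := hclLip.continuous
            fun_prop
          exact (hF.continuousOn.mono hsub).comp this
            (fun t ht => ⟨ht, hs, by simpa using hcl _⟩)
        norm_le := fun t ht y _ => hB t ht _ _ hs (by simpa using hcl _)
        mul_max_le := by simp [hh.le] }
    exact hPL.exists_eq_forall_mem_Icc_hasDerivWithinAt₀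
  choose! ζ hζ0 hζ using hex
  set C := (M : ℝ) * gronwallBound 0 M 1 h
  have hC : 0 ≤ C := mul_nonneg M.2 (gronwallBound_zero_one_nonneg M.2 hh.le)
  have hclose : ∀ s, |s| ≤ ε / 2 → ∀ t ∈ Icc 0 h, |ζ s t - z t| ≤ C * |s| := by
    intro s hs t ht
    have := abs_le_of_deriv_bound (f := fun t => ζ s t - z t) (K := M) (κ := M * |s|) M.2
      (by positivity) (fun t ht => (hζ s hs t ht).sub (hz t ht)) (by simp [hζ0 s hs]) ?_ t ht
    · calc _ ≤ _ := this
        _ = _ := by simp only [C]; ring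
    · intro t ht
      have e1 := hFtLip s hs t ht (ζ s t) (z t)
      have e2 := hLip t ht (0, z t) (s, z t) (by simp; positivity) (by simp) hs (by simp)
      have e3 : Ft s t (z t) = F (t, s, z t) := by simp [Ft, cl]
      have e4 : ‖(s, z t) - ((0 : ℝ), z t)‖ = |s| := by simp
      rw [e4] at e2
      rw [e3] at e1
      calc _ = |(Ft s t (ζ s t) - F (t, s, z t)) + (F (t, s, z t) - F (t, 0, z t))| := by
            congr 1; ring
        _ ≤ _ := (abs_add_le _ _).trans (add_le_add e1 e2)
  -- The bound 1 / (C + 1) forces C|s| ≤ 1, so the solution stays where the truncation is inactive.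
  refine ⟨min (ε / 2) (1 / (C + 1)), C, by positivity,
    (min_le_left _ _).trans_lt (by linarith), hC, fun p => ζ p.2 p.1, fun s hs => ?_⟩
  have hs1 : |s| < min (ε / 2) (1 / (C + 1)) := abs_lt.2 hs
  have hs2 : |s| ≤ ε / 2 := (hs1.trans_le (min_le_left _ _)).le
  have hs3 : C * |s| ≤ 1 := by
    have : |s| ≤ 1 / (C + 1) := (hs1.trans_le (min_le_right _ _)).le
    rw [le_div_iff₀ (by positivity)] at this
    nlinarith [abs_nonneg s]
  refine ⟨hζ0 s hs2, fun t ht => ⟨?_, hclose s hs2 t ht⟩⟩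
  have := hζ s hs2 t ht
  simp only [Ft] at this
  rwa [hcl1 _ ((hclose s hs2 t ht).trans hs3), add_sub_cancel] at this

/-- Both solutions lie in a common ball, on which `F` is Lipschitz in y; Grönwall with κ = 0
finishes. -/
theorem solution_unique {h ε s : ℝ} (hh : 0 < h) {F : ℝ × ℝ × ℝ → ℝ}
    (hF : ContDiffOn ℝ 1 F (paramDomain h ε)) (hs : s ∈ Ioo (-ε) ε) {y z : ℝ → ℝ}
    (hy : ∀ t ∈ Icc 0 h, HasDerivWithinAt y (F (t, s, y t)) (Icc 0 h) t)
    (hz : ∀ t ∈ Icc 0 h, HasDerivWithinAt z (F (t, s, z t)) (Icc 0 h) t)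
    (h0 : y 0 = z 0) : ∀ t ∈ Icc 0 h, y t = z t := by
  obtain ⟨D, hD, hFD⟩ := exists_slice_fderiv hh hF
  have hzc : ContinuousOn z (Icc 0 h) := fun t ht => (hz t ht).continuousWithinAt
  have hyc : ContinuousOn y (Icc 0 h) := fun t ht => (hy t ht).continuousWithinAt
  obtain ⟨R₁, hR₁⟩ := isCompact_Icc.exists_bound_of_continuousOn hzc
  obtain ⟨R₂, hR₂⟩ := isCompact_Icc.exists_bound_of_continuousOn hyc
  have hK : IsCompact (Icc 0 h ×ˢ ({s} ×ˢ Metric.closedBall (0 : ℝ) (max R₁ R₂))) :=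
    isCompact_Icc.prod (isCompact_singleton.prod (isCompact_closedBall _ _))
  obtain ⟨M₀, hM₀⟩ := hK.exists_bound_of_continuousOn (hD.mono (by
    rintro ⟨t, s', y⟩ ⟨h1, h2, -⟩
    obtain rfl : s' = s := h2
    exact ⟨h1, hs, trivial⟩))
  intro t ht
  have := abs_le_of_deriv_bound (f := fun t => y t - z t) (K := max M₀ 0) (κ := 0) (le_max_right _ _)
      le_rfl (fun t ht => (hy t ht).sub (hz t ht)) (by simp [h0]) ?_ t ht
  · rw [zero_mul] at this
    exact sub_eq_zero.1 (abs_eq_zero.1 (le_antisymm this (abs_nonneg _)))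
  · intro t ht
    have hconv : Convex ℝ ({s} ×ˢ Metric.closedBall (0 : ℝ) (max R₁ R₂)) :=
      (convex_singleton _).prod (convex_closedBall _ _)
    have := hconv.norm_image_sub_le_of_norm_hasFDerivWithin_le
      (f := fun q => F (t, q)) (f' := fun q => D (t, q)) (C := max M₀ 0) (fun q hq => ?_)
      (fun q hq => ?_) (x := (s, z t)) (y := (s, y t)) ?_ ?_
    · simpa using this
    · refine (hFD t ht q ⟨?_, trivial⟩).hasFDerivWithinAt
      obtain h1 : q.1 = s := hq.1
      rwa [h1]
    · exact (hM₀ (t, q) ⟨ht, hq⟩).trans (le_max_left _ _)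
    · exact ⟨rfl, by simpa using Or.inl (hR₁ t ht)⟩
    · exact ⟨rfl, by simpa using Or.inr (hR₂ t ht)⟩

/-- Differentiability of the final value with respect to the parameter: the derivative solves the
linearized equation. -/
theorem hasDerivAt_solution_family {h ε : ℝ} (hh : 0 < h) (hε : 0 < ε) {F : ℝ × ℝ × ℝ → ℝ}
    (hF : ContDiffOn ℝ 1 F (paramDomain h ε)) {z w a b : ℝ → ℝ}
    (hz : ∀ t ∈ Icc 0 h, HasDerivWithinAt z (F (t, 0, z t)) (Icc 0 h) t)
    {Z : ℝ × ℝ → ℝ} (hZ : ∀ s ∈ Ioo (-ε) ε, Z (0, s) = z 0 ∧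
      ∀ t ∈ Icc 0 h, HasDerivWithinAt (fun τ => Z (τ, s)) (F (t, s, Z (t, s))) (Icc 0 h) t)
    (ha : ∀ t ∈ Icc 0 h, HasDerivAt (fun y => F (t, 0, y)) (a t) (z t))
    (hb : ∀ t ∈ Icc 0 h, HasDerivAt (fun s => F (t, s, z t)) (b t) 0)
    (hw0 : w 0 = 0)
    (hw : ∀ t ∈ Icc 0 h, HasDerivWithinAt w (a t * w t + b t) (Icc 0 h) t) :
    HasDerivAt (fun s => Z (h, s)) (w h) 0 := by
  obtain ⟨D, hD, hFD⟩ := exists_slice_fderiv hh hF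
  obtain ⟨δ, C, hδ, hδε, hC, Y, hY⟩ := exists_solution_family hh hε hF hz
  have hzc : ContinuousOn z (Icc 0 h) := fun t ht => (hz t ht).continuousWithinAt
  have h0ε : (0 : ℝ) ∈ Ioo (-ε) ε := ⟨by linarith, hε⟩
  have hZz : ∀ s ∈ Ioo (-δ) δ, ∀ t ∈ Icc 0 h, |Z (t, s) - z t| ≤ C * |s| := by
    intro s hs t ht
    have hs' : s ∈ Ioo (-ε) ε := ⟨by linarith [hs.1], by linarith [hs.2]⟩
    -- Nothing is assumed about the dependence of `Z` on s: uniqueness identifies it with the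
    -- constructed family, which carries the O(|s|) estimate.
    have := solution_unique hh hF hs' (hZ s hs').2 (fun t ht => ((hY s hs).2 t ht).1)
      (by rw [(hZ s hs').1, (hY s hs).1]) t ht
    rw [this]
    exact ((hY s hs).2 t ht).2
  have hDa : ∀ t ∈ Icc 0 h, ∀ u v, D (t, 0, z t) (u, v) = b t * u + a t * v := by
    intro t ht u v
    have h1 := hFD t ht (0, z t) ⟨h0ε, trivial⟩
    have h2 : D (t, 0, z t) (0, 1) = a t := by
      have : HasDerivAt (fun y : ℝ => ((0 : ℝ), y)) ((0 : ℝ), (1 : ℝ)) (z t) :=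
        (hasDerivAt_const _ _).prodMk (hasDerivAt_id _)
      exact (h1.comp_hasDerivAt (z t) this).unique (ha t ht)
    have h3 : D (t, 0, z t) (1, 0) = b t := by
      have : HasDerivAt (fun s : ℝ => (s, z t)) ((1 : ℝ), (0 : ℝ)) 0 :=
        (hasDerivAt_id _).prodMk (hasDerivAt_const _ _)
      exact (HasFDerivAt.comp_hasDerivAt (f := fun s : ℝ => (s, z t)) (0 : ℝ) h1 this).unique
        (hb t ht)
    have h4 : ((u, v) : ℝ × ℝ) = u • ((1 : ℝ), (0 : ℝ)) + v • ((0 : ℝ), (1 : ℝ)) := by simp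
    rw [h4, map_add, map_smul, map_smul, h2, h3]
    simp [mul_comm]
  -- uniform continuity of the differential near the unperturbed solution
  have hunif : ∀ κ > 0, ∃ r > 0, r ≤ δ ∧ ∀ t ∈ Icc 0 h, ∀ s y, |s| < r → |y - z t| < r →
      ‖D (t, s, y) - D (t, 0, z t)‖ ≤ κ := by
    intro κ hκ
    have hK := isCompact_tube (r := δ) hzc 1
    have huc := hK.uniformContinuousOn_of_continuous (hD.mono (by
      rintro ⟨t, s, y⟩ ⟨h1, h2, -⟩
      have := abs_le.1 h2
      exact ⟨h1, ⟨by simp only at this ⊢; linarith, by simp only at this ⊢; linarith⟩, trivial⟩))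
    rw [Metric.uniformContinuousOn_iff] at huc
    obtain ⟨r, hr, H⟩ := huc κ hκ
    refine ⟨min r (min δ 1), by positivity, (min_le_right _ _).trans (min_le_left _ _),
      fun t ht s y hs hy => ?_⟩
    rw [lt_min_iff, lt_min_iff] at hs hy
    have := H (t, s, y) ⟨ht, hs.2.1.le, hy.2.2.le⟩ (t, 0, z t) ⟨ht, by simp [hδ.le], by simp⟩
      (by simp [Prod.dist_eq, Real.dist_eq, hs.1, hy.1])
    rw [dist_eq_norm] at this
    exact this.le
  -- a bound for the coefficient of the linearized equation
  obtain ⟨K₀, hK₀⟩ := (isCompact_tube (r := 0) hzc 0).exists_bound_of_continuousOn (hD.mono (by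
      rintro ⟨t, s, y⟩ ⟨h1, h2, -⟩
      have : s = 0 := abs_eq_zero.1 (le_antisymm h2 (abs_nonneg _))
      exact ⟨h1, by rw [this]; exact h0ε, trivial⟩))
  set K := max K₀ 0
  have hK0 : 0 ≤ K := le_max_right _ _
  have haK : ∀ t ∈ Icc 0 h, |a t| ≤ K := by
    intro t ht
    have h1 := (D (t, 0, z t)).le_opNorm (0, 1)
    rw [hDa t ht] at h1
    have h2 := hK₀ (t, 0, z t) ⟨ht, by simp, by simp⟩
    have h3 : ‖((0 : ℝ), (1 : ℝ))‖ = 1 := by simp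
    rw [h3] at h1
    have : |a t| ≤ ‖D (t, 0, z t)‖ := by simpa using h1
    exact this.trans (h2.trans (le_max_left _ _))
  set Γ := gronwallBound 0 K 1 h
  have hΓ : 0 ≤ Γ := gronwallBound_zero_one_nonneg hK0 hh.le
  have hZ0 : Z (h, 0) = z h := solution_unique hh hF h0ε (hZ 0 h0ε).2 hz (hZ 0 h0ε).1 h ⟨hh.le, le_rfl⟩
  rw [hasDerivAt_iff_isLittleO, Asymptotics.isLittleO_iff]
  intro c hc
  -- The factor 1 + C compensates ‖(s, Z - z)‖ ≤ (1 + C)|s|, and Γ + 1 absorbs the Grönwall factor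
  -- Γ. The remainder Z - z - s w then has an equation with inhomogeneity o(|s|).
  obtain ⟨r, hr, hrδ, H⟩ := hunif (c / ((1 + C) * (Γ + 1))) (by positivity)
  have hr' : 0 < r / (1 + C) := by positivity
  filter_upwards [Ioo_mem_nhds (neg_lt_zero.2 hr') hr'] with s hs
  have hs1 : |s| < r / (1 + C) := abs_lt.2 hs
  have hs2 : |s| * (1 + C) < r := (lt_div_iff₀ (by positivity)).1 hs1
  have hs3 : |s| < r := by nlinarith [abs_nonneg s]
  have hs4 : C * |s| < r := by nlinarith [abs_nonneg s]
  have hsδ : s ∈ Ioo (-δ) δ := abs_lt.1 (hs3.trans_le hrδ)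
  have hsε : s ∈ Ioo (-ε) ε := ⟨by linarith [hsδ.1], by linarith [hsδ.2]⟩
  have key := abs_le_of_deriv_bound (f := fun t => Z (t, s) - z t - s * w t) (K := K)
    (κ := c / ((1 + C) * (Γ + 1)) * ((1 + C) * |s|)) hK0 (by positivity)
    (fun t ht => (((hZ s hsε).2 t ht).sub (hz t ht)).sub ((hw t ht).const_mul s))
    (by simp [(hZ s hsε).1, hw0]) ?_ h ⟨hh.le, le_rfl⟩
  · rw [hZ0]
    simp only [sub_zero, smul_eq_mul, Real.norm_eq_abs]
    refine key.trans ?_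
    calc c / ((1 + C) * (Γ + 1)) * ((1 + C) * |s|) * Γ = c * |s| * (Γ / (Γ + 1)) := by
          field_simp
      _ ≤ c * |s| * 1 := by
          gcongr
          rw [div_le_one (by positivity)]; linarith
      _ = _ := mul_one _
  · intro t ht
    have hconv : Convex ℝ (Metric.ball (0 : ℝ) r ×ˢ Metric.ball (z t) r) :=
      (convex_ball _ _).prod (convex_ball _ _)
    have hq : |Z (t, s) - z t| < r := (hZz s hsδ t ht).trans_lt hs4
    have e1 := hconv.norm_image_sub_le_of_norm_hasFDerivWithin_le' (𝕜 := ℝ)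
      (f := fun q => F (t, q)) (f' := fun q => D (t, q)) (φ := D (t, 0, z t))
      (C := c / ((1 + C) * (Γ + 1))) (fun q hq => ?_)
      (fun q hq => ?_) (x := (0, z t)) (y := (s, Z (t, s))) ?_ ?_
    · rw [Prod.mk_sub_mk, hDa t ht] at e1
      have e2 : ‖(s - 0, Z (t, s) - z t)‖ ≤ (1 + C) * |s| := by
        simp only [sub_zero, Prod.norm_mk, Real.norm_eq_abs]
        refine max_le ?_ ((hZz s hsδ t ht).trans ?_)
        · nlinarith [abs_nonneg s]
        · nlinarith [abs_nonneg s]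
      have e3 : |a t * (Z (t, s) - z t - s * w t)| ≤ K * |Z (t, s) - z t - s * w t| := by
        rw [abs_mul]; gcongr; exact haK t ht
      calc _ = |a t * (Z (t, s) - z t - s * w t) + (F (t, s, Z (t, s)) - F (t, 0, z t) -
              (b t * (s - 0) + a t * (Z (t, s) - z t)))| := by congr 1; ring
        _ ≤ _ := (abs_add_le _ _).trans (add_le_add e3 (e1.trans (by gcongr)))
    · refine (hFD t ht q ⟨?_, trivial⟩).hasFDerivWithinAt
      have : |q.1| < r := by simpa [Real.dist_eq] using hq.1
      exact ⟨by linarith [(abs_lt.1 this).1], by linarith [(abs_lt.1 this).2]⟩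
    · exact H t ht _ _ (by simpa [Real.dist_eq] using hq.1) (by simpa [Real.dist_eq] using hq.2)
    · exact ⟨by simpa using hr, by simpa using hr⟩
    · exact ⟨by simpa [Real.dist_eq] using hs3, by simpa [Real.dist_eq] using hq⟩

end ODE

/-! ### Pullbacks of the left Maurer-Cartan form -/

section MaurerCartan

variable {E : Type*} [NormedAddCommGroup E] [NormedSpace ℝ E]
  {G : Type*} [TopologicalSpace G] [ChartedSpace E G] [Group G]
  {F : Type*} [NormedAddCommGroup F] [NormedSpace ℝ F]
  {F' : Type*} [NormedAddCommGroup F'] [NormedSpace ℝ F']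

/-- The pullback `c*θ` of the left Maurer-Cartan form `θ` of `G` along a map `c` defined on `S`. -/
noncomputable def mcForm (S : Set F) (c : F → G) (p : F) : F →L[ℝ] E :=
  fderivWithin ℝ (fun x => extChartAt 𝓘(ℝ, E) (1 : G) ((c p)⁻¹ * c x)) S p

lemma hasMFDerivAt_extChartAt_self {M : Type*} [TopologicalSpace M] [ChartedSpace E M] (x : M) :
    HasMFDerivAt 𝓘(ℝ, E) 𝓘(ℝ, E) (extChartAt 𝓘(ℝ, E) x) x (ContinuousLinearMap.id ℝ E) := by
  refine ⟨continuousAt_extChartAt x, ?_⟩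
  refine (hasFDerivWithinAt_id _ _).congr_of_eventuallyEq ?_ ?_
  · refine mem_nhdsWithin_of_mem_nhds ?_
    filter_upwards [extChartAt_target_mem_nhds (I := 𝓘(ℝ, E)) x] with y hy
    simp only [writtenInExtChartAt, extChartAt_model_space_eq_id, Function.comp_apply,
      PartialEquiv.refl_coe, id_eq]
    exact (extChartAt 𝓘(ℝ, E) x).right_inv hy
  · simp only [writtenInExtChartAt, extChartAt_model_space_eq_id, Function.comp_apply,
      PartialEquiv.refl_coe, id_eq]
    exact (extChartAt 𝓘(ℝ, E) x).right_inv (mem_extChartAt_target x)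

/-- The base point is left variable because it will be (c p)⁻¹ * c p, equal to 1 only
propositionally. -/
lemma hasMFDerivAt_extChartAt_one {y : G} (hy : y = 1) :
    HasMFDerivAt 𝓘(ℝ, E) 𝓘(ℝ, E) (extChartAt 𝓘(ℝ, E) (1 : G)) y (ContinuousLinearMap.id ℝ E) := by
  subst hy
  exact hasMFDerivAt_extChartAt_self 1

lemma contMDiffAt_extChartAt_one {y : G} (hy : y = 1) :
    ContMDiffAt 𝓘(ℝ, E) 𝓘(ℝ, E) ∞ (extChartAt 𝓘(ℝ, E) (1 : G)) y := by
  subst hy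
  exact contMDiffAt_extChartAt

variable [LieGroup 𝓘(ℝ, E) ∞ G]

lemma contMDiff_mul_left_top (g : G) : ContMDiff 𝓘(ℝ, E) 𝓘(ℝ, E) ∞ (fun x : G => g * x) :=
  contMDiff_mul_left

lemma hasMFDerivAt_mul_left (g x : G) :
    HasMFDerivAt 𝓘(ℝ, E) 𝓘(ℝ, E) (fun x : G => g * x) x
      (mfderiv 𝓘(ℝ, E) 𝓘(ℝ, E) (fun x : G => g * x) x) :=
  ((contMDiff_mul_left_top g).mdifferentiable (by simp) x).hasMFDerivAt

/-- The differential of left translation by the inverse, `T_gℒ_{g⁻¹} : T_gG → 𝔤`. -/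
noncomputable def leftTangentInv (g : G) : TangentSpace 𝓘(ℝ, E) g →L[ℝ] E :=
  let A : TangentSpace 𝓘(ℝ, E) g →L[ℝ] TangentSpace 𝓘(ℝ, E) (g⁻¹ * g) :=
    mfderiv 𝓘(ℝ, E) 𝓘(ℝ, E) (fun x : G => g⁻¹ * x) g
  A

/-- The preferred chart at 1 has identity differential there, so reading (c p)⁻¹ * c x in that chart
loses nothing to first order. -/
lemma mcForm_eq_of_hasMFDerivWithinAt {S : Set F} {c : F → G} {p : F}
    {c' : F →L[ℝ] TangentSpace 𝓘(ℝ, E) (c p)}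
    (hc : HasMFDerivWithinAt 𝓘(ℝ, F) 𝓘(ℝ, E) c S p c') (hS : UniqueDiffWithinAt ℝ S p) :
    mcForm S c p = (leftTangentInv (c p)).comp c' := by
  have h1 := (hasMFDerivAt_mul_left (c p)⁻¹ (c p)).comp_hasMFDerivWithinAt p hc
  have h2 := (hasMFDerivAt_extChartAt_one (E := E) (inv_mul_cancel (c p))).comp_hasMFDerivWithinAt
    p h1
  have h3 : HasFDerivWithinAt (fun x => extChartAt 𝓘(ℝ, E) (1 : G) ((c p)⁻¹ * c x))
      ((leftTangentInv (c p)).comp c') S p := h2.hasFDerivWithinAt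
  exact h3.fderivWithin hS

lemma mcForm_apply {S : Set F} {c : F → G} {p : F}
    (hc : MDifferentiableWithinAt 𝓘(ℝ, F) 𝓘(ℝ, E) c S p) (hS : UniqueDiffWithinAt ℝ S p) (v : F) :
    mcForm S c p v = leftTangentInv (c p) (mfderivWithin 𝓘(ℝ, F) 𝓘(ℝ, E) c S p v) := by
  rw [mcForm_eq_of_hasMFDerivWithinAt hc.hasMFDerivWithinAt hS]
  rfl

lemma leftTangentInv_leftTangent (g : G) (ξ : E) : leftTangentInv g (leftTangent g ξ) = ξ := by
  have h1 : HasMFDerivAt 𝓘(ℝ, E) 𝓘(ℝ, E) (fun x : G => g⁻¹ * x) (g * 1)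
      (mfderiv 𝓘(ℝ, E) 𝓘(ℝ, E) (fun x : G => g⁻¹ * x) (g * 1)) := hasMFDerivAt_mul_left _ _
  have h2 := h1.comp (1 : G) (hasMFDerivAt_mul_left g 1)
  have h3 : (fun x : G => g⁻¹ * x) ∘ (fun x : G => g * x) = id := by ext x; simp
  rw [h3] at h2
  have h4 := hasMFDerivAt_unique h2 (hasMFDerivAt_id (I := 𝓘(ℝ, E)) (1 : G))
  have h5 := congrArg (fun A => A ξ) h4
  -- Transport between the fibres at g * 1 and g, whose types agree only after unfolding to E.
  have h6 : ∀ g' : G, g' = g → ∀ v : E, (show E from mfderiv 𝓘(ℝ, E) 𝓘(ℝ, E) (fun x : G => g⁻¹ * x) g' v)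
     = mfderiv 𝓘(ℝ, E) 𝓘(ℝ, E) (fun x : G => g⁻¹ * x) g v := by
    rintro g' rfl v; rfl
  exact (h6 (g * 1) (mul_one g) _).symm.trans h5

lemma leftTangent_leftTangentInv (g : G) (v : TangentSpace 𝓘(ℝ, E) g) :
    leftTangent g (leftTangentInv g v) = v := by
  have h1 : HasMFDerivAt 𝓘(ℝ, E) 𝓘(ℝ, E) (fun x : G => g * x) (g⁻¹ * g)
      (mfderiv 𝓘(ℝ, E) 𝓘(ℝ, E) (fun x : G => g * x) (g⁻¹ * g)) := hasMFDerivAt_mul_left _ _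
  have h2 := h1.comp g (hasMFDerivAt_mul_left g⁻¹ g)
  have h3 : (fun x : G => g * x) ∘ (fun x : G => g⁻¹ * x) = id := by ext x; simp
  rw [h3] at h2
  have h4 := hasMFDerivAt_unique h2 (hasMFDerivAt_id (I := 𝓘(ℝ, E)) g)
  have h5 := congrArg (fun A => A v) h4
  have h6 : ∀ g' : G, g' = 1 → ∀ v : E, (show E from mfderiv 𝓘(ℝ, E) 𝓘(ℝ, E) (fun x : G => g * x) g' v)
     = mfderiv 𝓘(ℝ, E) 𝓘(ℝ, E) (fun x : G => g * x) 1 v := by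
    rintro g' rfl v; rfl
  exact (h6 (g⁻¹ * g) (inv_mul_cancel g) _).symm.trans h5

/-- Joint smoothness at the diagonal, where the group difference is 1 and the chart is smooth. The
Maurer-Cartan pullback is the partial derivative in the second slot along the diagonal, so its
smoothness in p follows. -/
lemma contDiffWithinAt_logDiff {S : Set F} {c : F → G} (hc : ContMDiffOn 𝓘(ℝ, F) 𝓘(ℝ, E) ∞ c S)
    {p : F} (hp : p ∈ S) :
    ContDiffWithinAt ℝ ∞ (fun q : F × F => extChartAt 𝓘(ℝ, E) (1 : G) ((c q.1)⁻¹ * c q.2)) (S ×ˢ S)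
      (p, p) := by
  rw [← contMDiffWithinAt_iff_contDiffWithinAt]
  have h1 : ContMDiffWithinAt 𝓘(ℝ, F × F) 𝓘(ℝ, E) ∞ (fun q : F × F => c q.1) (S ×ˢ S) (p, p) :=
    ContMDiffWithinAt.comp (p, p) (hc p hp) (contDiff_fst.contMDiff.contMDiffAt.contMDiffWithinAt)
      (fun q hq => hq.1)
  have h2 : ContMDiffWithinAt 𝓘(ℝ, F × F) 𝓘(ℝ, E) ∞ (fun q : F × F => c q.2) (S ×ˢ S) (p, p) :=
    ContMDiffWithinAt.comp (p, p) (hc p hp) (contDiff_snd.contMDiff.contMDiffAt.contMDiffWithinAt)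
      (fun q hq => hq.2)
  exact (contMDiffAt_extChartAt_one (inv_mul_cancel (c p))).comp_contMDiffWithinAt (p, p)
    (h1.inv.mul h2)

lemma differentiableWithinAt_logDiff {S : Set F} {c : F → G}
    (hc : ContMDiffOn 𝓘(ℝ, F) 𝓘(ℝ, E) ∞ c S) {p : F} (hp : p ∈ S) :
    DifferentiableWithinAt ℝ (fun x => extChartAt 𝓘(ℝ, E) (1 : G) ((c p)⁻¹ * c x)) S p := by
  have h1 := (contDiffWithinAt_logDiff hc hp).differentiableWithinAt (by simp)
  exact h1.comp (f := fun x => (p, x)) p (by fun_prop) (fun x hx => ⟨hp, hx⟩)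

lemma contDiffOn_mcForm {S : Set F} {c : F → G} (hc : ContMDiffOn 𝓘(ℝ, F) 𝓘(ℝ, E) ∞ c S)
    (hS : UniqueDiffOn ℝ S) : ContDiffOn ℝ ∞ (mcForm S c : F → F →L[ℝ] E) S := fun p hp =>
  ContDiffWithinAt.fderivWithin (f := fun p x => extChartAt 𝓘(ℝ, E) (1 : G) ((c p)⁻¹ * c x))
    (g := id) (t := S) (contDiffWithinAt_logDiff hc hp) contDiffWithinAt_id hS (by simp) hp
    (fun _ h => h)

/-- Naturality of pullback. The factorization is required only near p, so that local charts may be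
used. -/
lemma mcForm_comp {S : Set F} {T : Set F'} {c : F → G} {c₁ : F' → G} {f : F → F'} {p : F}
    (hc₁ : ContMDiffOn 𝓘(ℝ, F') 𝓘(ℝ, E) ∞ c₁ T) (hf : DifferentiableWithinAt ℝ f S p)
    (hp : p ∈ S) (hS : UniqueDiffWithinAt ℝ S p)
    (h : ∀ᶠ x in 𝓝[S] p, f x ∈ T ∧ c x = c₁ (f x)) :
    mcForm (E := E) S c p = (mcForm T c₁ (f p)).comp (fderivWithin ℝ f S p) := by
  obtain ⟨hfp, hcp⟩ := h.self_of_nhdsWithin hp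
  have h1 := (differentiableWithinAt_logDiff hc₁ hfp).hasFDerivWithinAt
  have h2 := h1.comp_of_tendsto p hf.hasFDerivWithinAt
    (tendsto_nhdsWithin_iff.2 ⟨hf.continuousWithinAt, h.mono fun x hx => hx.1⟩)
  have h3 : HasFDerivWithinAt (fun x => extChartAt 𝓘(ℝ, E) (1 : G) ((c p)⁻¹ * c x))
      ((mcForm (E := E) T c₁ (f p)).comp (fderivWithin ℝ f S p)) S p := by
    refine h2.congr_of_eventuallyEq ?_ ?_
    · filter_upwards [h] with x hx
      simp only [hx.2, hcp, Function.comp_apply]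
    · simp only [hcp, Function.comp_apply]
  exact h3.fderivWithin hS

/-- From ρ(c x) = ρ(c p) ρ((c p)⁻¹ c x), only the derivative of ρ at the identity is needed. -/
lemma hasFDerivWithinAt_rep {X : Type*} [NormedAddCommGroup X] [NormedSpace ℝ X]
    (ρ : G →* (X →L[ℝ] X)) (hρ : ContMDiff 𝓘(ℝ, E) 𝓘(ℝ, X →L[ℝ] X) ∞ ρ)
    {S : Set F} {c : F → G} (hc : ContMDiffOn 𝓘(ℝ, F) 𝓘(ℝ, E) ∞ c S) {p : F} (hp : p ∈ S)
    (hS : UniqueDiffWithinAt ℝ S p) :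
    HasFDerivWithinAt (fun x => ρ (c x))
      ((ContinuousLinearMap.compL ℝ X X X (ρ (c p))).comp ((infRep (E := E) ρ).comp (mcForm S c p))) S p := by
  have hc' := ((hc p hp).mdifferentiableWithinAt (by simp)).hasMFDerivWithinAt
  have h1 := (hasMFDerivAt_mul_left (c p)⁻¹ (c p)).comp_hasMFDerivWithinAt p hc'
  have hρ' : ∀ y : G, y = 1 → HasMFDerivAt 𝓘(ℝ, E) 𝓘(ℝ, X →L[ℝ] X) ρ y (infRep ρ : E →L[ℝ] (X →L[ℝ] X)) := by
    rintro y rfl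
    exact (hρ.mdifferentiable (by simp) 1).hasMFDerivAt
  have h2 := (hρ' _ (inv_mul_cancel (c p))).comp_hasMFDerivWithinAt p h1
  have h3 : HasFDerivWithinAt (fun x => ρ ((c p)⁻¹ * c x))
      ((infRep (E := E) ρ).comp (mcForm S c p)) S p := by
    rw [mcForm_eq_of_hasMFDerivWithinAt hc' hS]
    exact h2.hasFDerivWithinAt
  have h4 := (ContinuousLinearMap.compL ℝ X X X (ρ (c p))).hasFDerivAt.comp_hasFDerivWithinAt p h3
  refine HasFDerivWithinAt.congr' h4 (fun x _ => ?_) hp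
  simp only [Function.comp_apply, ContinuousLinearMap.compL_apply]
  rw [← ContinuousLinearMap.mul_def, ← map_mul, mul_inv_cancel_left]

end MaurerCartan

/-! ### The Maurer-Cartan structure equation -/

section StructureEquation

variable {E : Type*} [NormedAddCommGroup E] [NormedSpace ℝ E]
  {G : Type*} [TopologicalSpace G] [ChartedSpace E G]
  {F : Type*} [NormedAddCommGroup F] [NormedSpace ℝ F]

lemma contMDiffOn_chart_symm {e : OpenPartialHomeomorph G E}
    (he : e ∈ IsManifold.maximalAtlas 𝓘(ℝ, E) ∞ G) :
    ContMDiffOn 𝓘(ℝ, E) 𝓘(ℝ, E) ∞ e.symm e.target :=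
  contMDiffOn_symm_of_mem_maximalAtlas he

lemma mdifferentiable_chart {e : OpenPartialHomeomorph G E}
    (he : e ∈ IsManifold.maximalAtlas 𝓘(ℝ, E) ∞ G) : e.MDifferentiable 𝓘(ℝ, E) 𝓘(ℝ, E) :=
  ⟨(contMDiffOn_of_mem_maximalAtlas he).mdifferentiableOn (by simp),
    (contMDiffOn_symm_of_mem_maximalAtlas he).mdifferentiableOn (by simp)⟩

lemma mlieBracket_eq_lieBracket (V W : (x : E) → TangentSpace 𝓘(ℝ, E) x) (q : E) :
    VectorField.mlieBracket 𝓘(ℝ, E) V W q = VectorField.lieBracket ℝ V W q := by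
  have h := congrFun (VectorField.mlieBracketWithin_eq_lieBracketWithin (V := V) (W := W)
    (s := univ)) q
  rw [VectorField.mlieBracketWithin_univ] at h
  exact h.trans (congrFun VectorField.lieBracketWithin_univ q)

variable [Group G] [LieGroup 𝓘(ℝ, E) ∞ G]

lemma mcForm_chart_apply {e : OpenPartialHomeomorph G E}
    (he : e ∈ IsManifold.maximalAtlas 𝓘(ℝ, E) ∞ G) {q : E} (hq : q ∈ e.target) (v : E) :
    mcForm e.target e.symm q v =
      leftTangentInv (e.symm q) (mfderiv 𝓘(ℝ, E) 𝓘(ℝ, E) e.symm q v) := by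
  rw [mcForm_apply (((contMDiffOn_chart_symm he) q hq).mdifferentiableWithinAt (by simp))
    (e.open_target.uniqueDiffWithinAt hq), mfderivWithin_of_isOpen e.open_target hq]

lemma isInvertible_mcForm_chart {e : OpenPartialHomeomorph G E}
    (he : e ∈ IsManifold.maximalAtlas 𝓘(ℝ, E) ∞ G) {q : E} (hq : q ∈ e.target) :
    (mcForm e.target e.symm q : E →L[ℝ] E).IsInvertible := by
  let B : TangentSpace 𝓘(ℝ, E) (e.symm q) →L[ℝ] E := mfderiv 𝓘(ℝ, E) 𝓘(ℝ, E) e (e.symm q)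
  refine ContinuousLinearMap.IsInvertible.of_inverse (g := B.comp (leftTangent (e.symm q))) ?_ ?_
  · ext ξ
    have h1 := congrArg (fun A => A (leftTangent (e.symm q) ξ))
      ((mdifferentiable_chart he).symm_comp_deriv (e.map_target hq))
    have h2 : ∀ q', q' = q → ∀ v : E, (show E from mfderiv 𝓘(ℝ, E) 𝓘(ℝ, E) e.symm q' v) =
      mfderiv 𝓘(ℝ, E) 𝓘(ℝ, E) e.symm q v := by rintro q' rfl v; rfl
    have h3 : mfderiv 𝓘(ℝ, E) 𝓘(ℝ, E) e.symm q (B (leftTangent (e.symm q) ξ)) =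
      leftTangent (e.symm q) ξ := (h2 _ (e.right_inv hq) _).symm.trans h1
    change mcForm e.target e.symm q (B (leftTangent (e.symm q) ξ)) = ξ
    rw [mcForm_chart_apply he hq, h3, leftTangentInv_leftTangent]
  · ext v
    change B (leftTangent (e.symm q) (mcForm e.target e.symm q v)) = v
    rw [mcForm_chart_apply he hq, leftTangent_leftTangentInv]
    exact congrArg (fun A => A v) ((mdifferentiable_chart he).comp_symm_deriv hq)

variable [FiniteDimensional ℝ E]

/-- Pull the left-invariant fields back to fields V_ξ on the chart. Differentiating the constant
Λ(V_ξ) = ξ expresses DΛ through DV_ξ, and the antisymmetrization becomes the Lie bracket of the V's,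
which is the pullback of the bracket of left-invariant fields. Evaluating at ξ = Λ(q)v and Λ(q)w
recovers v and w themselves. -/
lemma structure_equation_chart {e : OpenPartialHomeomorph G E}
    (he : e ∈ IsManifold.maximalAtlas 𝓘(ℝ, E) ∞ G) {q : E} (hq : q ∈ e.target) (v w : E) :
    fderiv ℝ (mcForm e.target e.symm : E → E →L[ℝ] E) q v w -
      fderiv ℝ (mcForm e.target e.symm : E → E →L[ℝ] E) q w v =
      -ad G (mcForm e.target e.symm q v) (mcForm e.target e.symm q w) := by
  have : CompleteSpace E := FiniteDimensional.complete ℝ E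
  have h3 : (minSmoothness ℝ 3) ≤ (∞ : WithTop ℕ∞) := by
    rw [minSmoothness_of_isRCLikeNormedField]; exact WithTop.coe_le_coe.2 (le_top (a := (3 : ℕ∞)))
  have h2' : (minSmoothness ℝ 2) ≤ (∞ : WithTop ℕ∞) := by
    rw [minSmoothness_of_isRCLikeNormedField]; exact WithTop.coe_le_coe.2 (le_top (a := (2 : ℕ∞)))
  have : LieGroup 𝓘(ℝ, E) (minSmoothness ℝ 3) G := LieGroup.of_le (n := ∞) h3
  set Λ : E → E →L[ℝ] E := mcForm e.target e.symm with hΛ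
  let W : E → (x : G) → TangentSpace 𝓘(ℝ, E) x := fun ξ =>
    mulInvariantVectorField (I := 𝓘(ℝ, E)) (G := G) ξ
  let V : E → E → E := fun ξ => VectorField.mpullback 𝓘(ℝ, E) 𝓘(ℝ, E) e.symm (W ξ)
  have hΛd : ∀ x ∈ e.target, DifferentiableAt ℝ Λ x := fun x hx =>
    ((contDiffOn_mcForm (contMDiffOn_chart_symm he) e.open_target.uniqueDiffOn).contDiffAt
      (e.open_target.mem_nhds hx)).differentiableAt (by simp)
  have hinv : ∀ x ∈ e.target, (mfderiv 𝓘(ℝ, E) 𝓘(ℝ, E) e.symm x).IsInvertible := fun x hx =>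
    ⟨(mdifferentiable_chart he).symm.mfderiv hx, rfl⟩
  have hΛV : ∀ x ∈ e.target, ∀ ξ, Λ x (V ξ x) = ξ := by
    intro x hx ξ
    rw [hΛ, mcForm_chart_apply he hx]
    have : mfderiv 𝓘(ℝ, E) 𝓘(ℝ, E) e.symm x (V ξ x) = leftTangent (e.symm x) ξ :=
      (hinv x hx).self_apply_inverse _
    rw [this, leftTangentInv_leftTangent]
  have hΛi : ∀ x ∈ e.target, (Λ x).IsInvertible := fun x hx => isInvertible_mcForm_chart he hx
  have hVeq : ∀ x ∈ e.target, ∀ ξ, V ξ x = (Λ x).inverse ξ := fun x hx ξ => by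
    conv_rhs => rw [← hΛV x hx ξ]
    exact ((hΛi x hx).inverse_apply_self _).symm
  have hVd : ∀ ξ, DifferentiableAt ℝ (V ξ) q := by
    intro ξ
    have h1 : DifferentiableAt ℝ (fun x => (Λ x).inverse) q :=
      ((hΛi q hq).contDiffAt_map_inverse (n := 1)).differentiableAt one_ne_zero |>.comp q (hΛd q hq)
    refine (h1.clm_apply (differentiableAt_const ξ)).congr_of_eventuallyEq ?_
    filter_upwards [e.open_target.mem_nhds hq] with x hx using hVeq x hx ξ
  have hder : ∀ ξ x, fderiv ℝ Λ q x (V ξ q) + Λ q (fderiv ℝ (V ξ) q x) = 0 := by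
    intro ξ x
    have h1 := (hΛd q hq).hasFDerivAt.clm_apply (hVd ξ).hasFDerivAt
    have h2 : HasFDerivAt (fun x => Λ x (V ξ x)) (0 : E →L[ℝ] E) q :=
      (hasFDerivAt_const ξ q).congr_of_eventuallyEq
        (by filter_upwards [e.open_target.mem_nhds hq] with x hx using hΛV x hx ξ)
    have := congrArg (fun A => A x) (h1.unique h2)
    simpa [add_comm] using this
  have hbr : ∀ ξ η, V (bracket G ξ η) q = fderiv ℝ (V η) q (V ξ q) - fderiv ℝ (V ξ) q (V η q) := by
    intro ξ η
    have h1 := VectorField.mpullback_mlieBracket (I := 𝓘(ℝ, E)) (I' := 𝓘(ℝ, E)) (n := ∞)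
      (f := e.symm) (x₀ := q) (V := W ξ) (W := W η)
      (mdifferentiableAt_mulInvariantVectorField _) (mdifferentiableAt_mulInvariantVectorField _)
      ((contMDiffOn_chart_symm he).contMDiffAt (e.open_target.mem_nhds hq)) h2'
    have h2 := mulInvariantVector_mlieBracket (I := 𝓘(ℝ, E)) (G := G) ξ η
    rw [← h2] at h1
    exact h1.trans (mlieBracket_eq_lieBracket (V ξ) (V η) q)
  have hv : V (Λ q v) q = v := by rw [hVeq q hq]; exact (hΛi q hq).inverse_apply_self _
  have hw : V (Λ q w) q = w := by rw [hVeq q hq]; exact (hΛi q hq).inverse_apply_self _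
  have h1 := congrArg (Λ q) (hbr (Λ q v) (Λ q w))
  rw [hΛV q hq, map_sub, hv, hw] at h1
  have h2 := hder (Λ q v) w
  have h3 := hder (Λ q w) v
  rw [hv] at h2
  rw [hw] at h3
  change _ = - bracket G (Λ q v) (Λ q w)
  rw [h1, eq_neg_of_add_eq_zero_left h2, eq_neg_of_add_eq_zero_left h3]
  abel

/-- The Maurer-Cartan structure equation `dω(a, b) = -[ω(a), ω(b)]` for `ω = c*θ`. -/
theorem structure_equation {S : Set F} {c : F → G} (hc : ContMDiffOn 𝓘(ℝ, F) 𝓘(ℝ, E) ∞ c S)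
    (hS : UniqueDiffOn ℝ S) {p : F} (hp : p ∈ S) (hp' : p ∈ closure (interior S)) (a b : F) :
    fderivWithin ℝ (mcForm S c : F → F →L[ℝ] E) S p a b -
      fderivWithin ℝ (mcForm S c : F → F →L[ℝ] E) S p b a =
      -ad G (mcForm S c p a) (mcForm S c p b) := by
  have : IsManifold 𝓘(ℝ, E) ∞ G := inferInstance
  set e := chartAt E (c p)
  have he : e ∈ IsManifold.maximalAtlas 𝓘(ℝ, E) ∞ G := IsManifold.chart_mem_maximalAtlas _
  have hcp : c p ∈ e.source := mem_chart_source E (c p)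
  set Q : F → E := fun x => e (c x)
  have hnear : ∀ x ∈ S, c x ∈ e.source → ∀ᶠ y in 𝓝[S] x, c y ∈ e.source := fun x hx hxe =>
    (hc x hx).continuousWithinAt.preimage_mem_nhdsWithin (e.open_source.mem_nhds hxe)
  have hQ : ContDiffWithinAt ℝ ∞ Q S p := by
    rw [← contMDiffWithinAt_iff_contDiffWithinAt]
    exact ContMDiffAt.comp_contMDiffWithinAt p (contMDiffAt_of_mem_maximalAtlas he hcp) (hc p hp)
  have hform : ∀ᶠ x in 𝓝[S] p, mcForm S c x =
      (mcForm e.target e.symm (Q x) : E →L[ℝ] E).comp (fderivWithin ℝ Q S x) := by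
    filter_upwards [hnear p hp hcp, self_mem_nhdsWithin] with x hxe hx
    have hQx : ContMDiffWithinAt 𝓘(ℝ, F) 𝓘(ℝ, E) ∞ Q S x :=
      ContMDiffAt.comp_contMDiffWithinAt x (contMDiffAt_of_mem_maximalAtlas he hxe) (hc x hx)
    refine mcForm_comp (contMDiffOn_chart_symm he)
      (hQx.contDiffWithinAt.differentiableWithinAt (by simp)) hx (hS x hx) ?_
    filter_upwards [hnear x hx hxe] with y hy
    exact ⟨e.map_source hy, (e.left_inv hy).symm⟩
  have hQp : Q p ∈ e.target := e.map_source hcp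
  have hΛ : HasFDerivAt (mcForm e.target e.symm : E → E →L[ℝ] E)
      (fderiv ℝ (mcForm e.target e.symm : E → E →L[ℝ] E) (Q p)) (Q p) :=
    (((contDiffOn_mcForm (contMDiffOn_chart_symm he) e.open_target.uniqueDiffOn).contDiffAt
      (e.open_target.mem_nhds hQp)).differentiableAt (by simp)).hasFDerivAt
  have hQd : HasFDerivWithinAt (fderivWithin ℝ Q S) (fderivWithin ℝ (fderivWithin ℝ Q S) S p) S p :=
    ((hQ.fderivWithin_right (m := 1) hS (by exact WithTop.coe_le_coe.2 le_top) hp).differentiableWithinAt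
      one_ne_zero).hasFDerivWithinAt
  have hQ1 := (hQ.differentiableWithinAt (by simp)).hasFDerivWithinAt
  have hder := ((hΛ.comp_hasFDerivWithinAt p hQ1).clm_comp hQd).congr_of_eventuallyEq hform
    (hform.self_of_nhdsWithin hp)
  -- Differentiating ω = Λ(Q) ∘ DQ also produces Λ(D²Q), which antisymmetrization kills. Symmetry of
  -- D²Q within `S` is where p ∈ closure (interior S) enters; it allows endpoints in time.
  have hsymm := hQ.isSymmSndFDerivWithinAt (n := ∞) (by
    rw [minSmoothness_of_isRCLikeNormedField]; exact WithTop.coe_le_coe.2 (le_top (a := (2 : ℕ∞))))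
    hS hp' hp
  have key := structure_equation_chart he hQp (fderivWithin ℝ Q S p a) (fderivWithin ℝ Q S p b)
  have hsymm' := hsymm.eq a b
  rw [hder.fderivWithin (hS p hp), hform.self_of_nhdsWithin hp]
  simp only [add_apply, ContinuousLinearMap.comp_apply,
    ContinuousLinearMap.compL_apply, ContinuousLinearMap.flip_apply, Function.comp_apply]
  rw [← key, hsymm']
  abel

end StructureEquation

/-! ### The fundamental lemma for the linearized action -/

section DuBoisReymond

variable {V : Type*} [NormedAddCommGroup V] [NormedSpace ℝ V]

/-- With the integrating factor exp(-∫a), u(h) = 0 says that a nonnegative continuous function has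
integral zero over [0, h]. -/
lemma eq_zero_of_linear_ode {h : ℝ} (hh : 0 < h) {a q : ℝ → ℝ} (ha : ContinuousOn a (Icc 0 h))
    (hq : ContinuousOn q (Icc 0 h)) (hq0 : ∀ t ∈ Icc 0 h, 0 ≤ q t)
    (H : ∀ u : ℝ → ℝ, u 0 = 0 → (∀ t ∈ Icc 0 h, HasDerivWithinAt u (a t * u t + q t) (Icc 0 h) t) →
      u h = 0) : ∀ t ∈ Ioo 0 h, q t = 0 := by
  set a' : ℝ → ℝ := IccExtend hh.le (domRestrict (Icc 0 h) a)
  set q' : ℝ → ℝ := IccExtend hh.le (domRestrict (Icc 0 h) q)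
  have ha' : Continuous a' := (continuousOn_iff_continuous_domRestrict.1 ha).Icc_extend'
  have hq' : Continuous q' := (continuousOn_iff_continuous_domRestrict.1 hq).Icc_extend'
  have ha'' : ∀ t ∈ Icc 0 h, a' t = a t := fun t ht => IccExtend_of_mem hh.le _ ht
  have hq'' : ∀ t ∈ Icc 0 h, q' t = q t := fun t ht => IccExtend_of_mem hh.le _ ht
  set C : ℝ → ℝ := fun t => ∫ x in (0 : ℝ)..t, a' x
  have hC : ∀ t, HasDerivAt C (a' t) t := fun t => ha'.integral_hasStrictDerivAt 0 t |>.hasDerivAt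
  have hCc : Continuous C := continuous_iff_continuousAt.2 fun t => (hC t).continuousAt
  have hNc : Continuous fun t => Real.exp (-C t) * q' t := by fun_prop
  set N : ℝ → ℝ := fun t => ∫ x in (0 : ℝ)..t, Real.exp (-C x) * q' x
  have hN : ∀ t, HasDerivAt N (Real.exp (-C t) * q' t) t := fun t =>
    hNc.integral_hasStrictDerivAt 0 t |>.hasDerivAt
  have hN0 : N 0 = 0 := by simp [N]
  have hNh : N h = 0 := by
    have := H (fun t => Real.exp (C t) * N t) (by simp [hN0]) (fun t ht => by
      have h1 := (((hC t).exp).mul (hN t)).hasDerivWithinAt (s := Icc 0 h)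
      have h2 : Real.exp (C t) * a' t * N t + Real.exp (C t) * (Real.exp (-C t) * q' t) =
          a t * (Real.exp (C t) * N t) + q t := by
        rw [ha'' t ht, hq'' t ht, ← mul_assoc (Real.exp (C t)), ← Real.exp_add]
        simp; ring
      rw [h2] at h1
      exact h1)
    simpa using this
  have hmono : MonotoneOn N (Icc 0 h) := monotoneOn_of_deriv_nonneg (convex_Icc 0 h)
    (fun t _ => (hN t).continuousAt.continuousWithinAt)
    (fun t _ => (hN t).differentiableAt.differentiableWithinAt)
    (fun t ht => by
      rw [(hN t).deriv]
      have ht' := interior_subset ht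
      rw [hq'' t ht']
      exact mul_nonneg (Real.exp_pos _).le (hq0 t ht'))
  have hNzero : ∀ t ∈ Icc 0 h, N t = 0 := fun t ht => le_antisymm
    (hNh ▸ hmono ht ⟨hh.le, le_rfl⟩ ht.2) (hN0 ▸ hmono ⟨le_rfl, hh.le⟩ ht ht.1)
  intro t ht
  have h1 : HasDerivAt N 0 t := (hasDerivAt_const t (0 : ℝ)).congr_of_eventuallyEq
    (by filter_upwards [Icc_mem_nhds ht.1 ht.2] with x hx using hNzero x hx)
  have h2 := (hN t).unique h1
  rw [hq'' t (Ioo_subset_Icc_self ht)] at h2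
  exact (mul_eq_zero.1 h2).resolve_left (Real.exp_pos _).ne'

/-- A fundamental lemma of the calculus of variations for the linearized Herglotz action. -/
theorem hasDerivWithinAt_momentum_of_forall_variation {h : ℝ} (hh : 0 < h)
    {p r : ℝ → StrongDual ℝ V} {a : ℝ → ℝ} (hp : ContDiffOn ℝ ∞ p (Icc 0 h))
    (hr : ContDiffOn ℝ ∞ r (Icc 0 h)) (ha : ContDiffOn ℝ ∞ a (Icc 0 h))
    (H : ∀ η : ℝ → V, ContDiffOn ℝ ∞ η (Icc 0 h) → η 0 = 0 → η h = 0 → ∀ w : ℝ → ℝ, w 0 = 0 →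
      (∀ t ∈ Icc 0 h, HasDerivWithinAt w
        (a t * w t + (p t (derivWithin η (Icc 0 h) t) + r t (η t))) (Icc 0 h) t) → w h = 0) :
    ∀ t ∈ Icc 0 h, HasDerivWithinAt p (r t + a t • p t) (Icc 0 h) t := by
  have hU := uniqueDiffOn_Icc hh
  have hp1 : ContDiffOn ℝ ∞ (derivWithin p (Icc 0 h)) (Icc 0 h) :=
    hp.derivWithin hU (by simp)
  have hpd : ∀ t ∈ Icc 0 h, HasDerivWithinAt p (derivWithin p (Icc 0 h) t) (Icc 0 h) t :=
    fun t ht => (hp.differentiableOn (by simp) t ht).hasDerivWithinAt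
  suffices ∀ t ∈ Icc 0 h, r t + a t • p t = derivWithin p (Icc 0 h) t by
    intro t ht; rw [this t ht]; exact hpd t ht
  suffices hv : ∀ v : V, ∀ t ∈ Icc 0 h,
      r t v + a t * p t v - derivWithin p (Icc 0 h) t v = 0 by
    intro t ht; ext v
    simpa using sub_eq_zero.1 (hv v t ht)
  intro v
  set f : ℝ → ℝ := fun t => r t v + a t * p t v - derivWithin p (Icc 0 h) t v
  have hf : ContDiffOn ℝ ∞ f (Icc 0 h) :=
    ((hr.clm_apply contDiffOn_const).add (ha.mul (hp.clm_apply contDiffOn_const))).sub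
      (hp1.clm_apply contDiffOn_const)
  -- The test field φv vanishes at the endpoints, and φf = t(h - t)f² is nonnegative.
  set φ : ℝ → ℝ := fun t => t * (h - t) * f t
  have hφ : ContDiffOn ℝ ∞ φ (Icc 0 h) :=
    ((contDiff_id.mul (contDiff_const.sub contDiff_id)).contDiffOn).mul hf
  have hφv : ContDiffOn ℝ ∞ (fun t => φ t • v) (Icc 0 h) := hφ.smul contDiffOn_const
  have hzero : ∀ t ∈ Ioo 0 h, φ t * f t = 0 := by
    refine eq_zero_of_linear_ode hh ha.continuousOn (hφ.continuousOn.mul hf.continuousOn) ?_ ?_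
    · intro t ht
      have : φ t * f t = t * (h - t) * (f t * f t) := by simp only [φ]; ring
      rw [this]
      exact mul_nonneg (mul_nonneg ht.1 (by linarith [ht.2])) (mul_self_nonneg _)
    · intro u hu0 hu
      -- Integration by parts: w = p(φv) + u solves the linearized equation exactly when u' = a u +
      -- φf, and w = u at the endpoints.
      have := H (fun t => φ t • v) hφv (by simp [φ]) (by simp [φ])
        (fun t => p t (φ t • v) + u t) (by simp [φ, hu0]) (fun t ht => by
          have h1 := ((hφv.differentiableOn (by simp)) t ht).hasDerivWithinAt
          have h2 := ((hpd t ht).clm_apply h1).add (hu t ht)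
          refine h2.congr_deriv ?_
          simp only [map_smul, smul_eq_mul, f]
          ring)
      simpa [φ] using this
  have hf0 : EqOn f (fun _ => 0) (Ioo 0 h) := by
    intro t ht
    have h1 := hzero t ht
    simp only [φ, mul_eq_zero] at h1
    have h2 := ht.1.ne'
    have h3 : h - t ≠ 0 := (sub_pos.2 ht.2).ne'
    tauto
  exact hf0.of_subset_closure hf.continuousOn continuousOn_const Ioo_subset_Icc_self
    (by rw [closure_Ioo hh.ne])

end DuBoisReymond

/-! ### First variation of the Herglotz action -/

section FirstVariation

variable {E : Type*} [NormedAddCommGroup E] [NormedSpace ℝ E]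
  {Y : Type*} [NormedAddCommGroup Y] [NormedSpace ℝ Y] {ℓ : E → ℝ → Y → ℝ}

lemma hasFDerivAt_partial_fst (hℓ : ContDiff ℝ ∞ fun y : E × ℝ × Y => ℓ y.1 y.2.1 y.2.2)
    (x : E) (z : ℝ) (α : Y) :
    HasFDerivAt (fun x => ℓ x z α) ((fderiv ℝ (fun y : E × ℝ × Y => ℓ y.1 y.2.1 y.2.2) (x, z, α)).comp
      (ContinuousLinearMap.inl ℝ E (ℝ × Y))) x :=
  ((hℓ.differentiable (by simp) (x, z, α)).hasFDerivAt).comp (f := fun x => (x, z, α)) x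
    (hasFDerivAt_prodMk_left x (z, α))

lemma hasDerivAt_partial_snd (hℓ : ContDiff ℝ ∞ fun y : E × ℝ × Y => ℓ y.1 y.2.1 y.2.2)
    (x : E) (z : ℝ) (α : Y) :
    HasDerivAt (fun w => ℓ x w α)
      (fderiv ℝ (fun y : E × ℝ × Y => ℓ y.1 y.2.1 y.2.2) (x, z, α) (0, 1, 0)) z :=
  ((hℓ.differentiable (by simp) (x, z, α)).hasFDerivAt).comp_hasDerivAt (f := fun w => (x, w, α)) z
    ((hasDerivAt_const z x).prodMk ((hasDerivAt_id z).prodMk (hasDerivAt_const z α)))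

lemma hasFDerivAt_partial_trd (hℓ : ContDiff ℝ ∞ fun y : E × ℝ × Y => ℓ y.1 y.2.1 y.2.2)
    (x : E) (z : ℝ) (α : Y) :
    HasFDerivAt (fun a => ℓ x z a) ((fderiv ℝ (fun y : E × ℝ × Y => ℓ y.1 y.2.1 y.2.2) (x, z, α)).comp
      ((ContinuousLinearMap.inr ℝ E (ℝ × Y)).comp (ContinuousLinearMap.inr ℝ ℝ Y))) α :=
  ((hℓ.differentiable (by simp) (x, z, α)).hasFDerivAt).comp (f := fun a => (x, z, a)) α
    ((hasFDerivAt_prodMk_right x (z, α)).comp α (hasFDerivAt_prodMk_right z α))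

lemma fderiv_eq_partials (hℓ : ContDiff ℝ ∞ fun y : E × ℝ × Y => ℓ y.1 y.2.1 y.2.2)
    (x : E) (z : ℝ) (α : Y) (u : E) (r : ℝ) (v : Y) :
    fderiv ℝ (fun y : E × ℝ × Y => ℓ y.1 y.2.1 y.2.2) (x, z, α) (u, r, v) =
      fderiv ℝ (fun x => ℓ x z α) x u + r * deriv (fun w => ℓ x w α) z
        + fderiv ℝ (fun a => ℓ x z a) α v := by
  rw [(hasFDerivAt_partial_fst hℓ x z α).fderiv, (hasDerivAt_partial_snd hℓ x z α).deriv,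
    (hasFDerivAt_partial_trd hℓ x z α).fderiv]
  simp only [ContinuousLinearMap.comp_apply, ContinuousLinearMap.inl_apply,
    ContinuousLinearMap.inr_apply]
  rw [← smul_eq_mul, ← map_smul, ← map_add, ← map_add]
  simp

lemma contDiffOn_momentum (hℓ : ContDiff ℝ ∞ fun y : E × ℝ × Y => ℓ y.1 y.2.1 y.2.2)
    {S : Set ℝ} {ξ : ℝ → E} {z : ℝ → ℝ} {α : ℝ → Y} (hξ : ContDiffOn ℝ ∞ ξ S)
    (hz : ContDiffOn ℝ ∞ z S) (hα : ContDiffOn ℝ ∞ α S) :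
    ContDiffOn ℝ ∞ (fun t => fderiv ℝ (fun x => ℓ x (z t) (α t)) (ξ t)) S :=
  (((hℓ.fderiv_right (m := ∞) (by simp)).comp_contDiffOn (hξ.prodMk (hz.prodMk hα))).clm_comp
    contDiffOn_const).congr fun t _ => (hasFDerivAt_partial_fst hℓ _ _ _).fderiv

lemma contDiffOn_lagrangian_family (hℓ : ContDiff ℝ ∞ fun y : E × ℝ × Y => ℓ y.1 y.2.1 y.2.2)
    {h ε : ℝ} {Ξ : ℝ × ℝ → E} {A : ℝ × ℝ → Y}
    (hΞ : ContDiffOn ℝ ∞ Ξ (Icc 0 h ×ˢ Ioo (-ε) ε))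
    (hA : ContDiffOn ℝ ∞ A (Icc 0 h ×ˢ Ioo (-ε) ε)) :
    ContDiffOn ℝ 1 (fun p : ℝ × ℝ × ℝ => ℓ (Ξ (p.1, p.2.1)) p.2.2 (A (p.1, p.2.1)))
      (paramDomain h ε) := by
  have h1 : ContDiffOn ℝ ∞ (fun p : ℝ × ℝ × ℝ => (p.1, p.2.1)) (paramDomain h ε) := by fun_prop
  have h2 : MapsTo (fun p : ℝ × ℝ × ℝ => (p.1, p.2.1)) (paramDomain h ε)
    (Icc 0 h ×ˢ Ioo (-ε) ε) := fun p hp => ⟨hp.1, hp.2.1⟩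
  have h3 : ContDiffOn ℝ ∞ (fun p : ℝ × ℝ × ℝ => p.2.2) (paramDomain h ε) := by fun_prop
  exact (hℓ.comp_contDiffOn ((hΞ.comp h1 h2).prodMk (h3.prodMk (hA.comp h1 h2)))).of_le
    (by exact WithTop.coe_le_coe.2 le_top)

/-- The first variation of the Herglotz action is the final value of the solution of the
linearized equation. -/
theorem hasDerivAt_action (hℓ : ContDiff ℝ ∞ fun y : E × ℝ × Y => ℓ y.1 y.2.1 y.2.2)
    {h ε : ℝ} (hh : 0 < h) (hε : 0 < ε) {ξ : ℝ → E} {z w : ℝ → ℝ} {α : ℝ → Y} {δξ : ℝ → E}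
    {δα : ℝ → Y} {Ξ : ℝ × ℝ → E} {A : ℝ × ℝ → Y} {Z : ℝ × ℝ → ℝ}
    (hz : ∀ t ∈ Icc 0 h, HasDerivWithinAt z (ℓ (ξ t) (z t) (α t)) (Icc 0 h) t)
    (hΞ : ContDiffOn ℝ ∞ Ξ (Icc 0 h ×ˢ Ioo (-ε) ε))
    (hA : ContDiffOn ℝ ∞ A (Icc 0 h ×ˢ Ioo (-ε) ε))
    (h0 : ∀ t ∈ Icc 0 h, Ξ (t, 0) = ξ t ∧ A (t, 0) = α t)
    (hδ : ∀ t ∈ Icc 0 h, HasDerivAt (fun s => Ξ (t, s)) (δξ t) 0 ∧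
      HasDerivAt (fun s => A (t, s)) (δα t) 0)
    (hZ : ∀ s ∈ Ioo (-ε) ε, Z (0, s) = z 0 ∧ ∀ t ∈ Icc 0 h,
      HasDerivWithinAt (fun τ => Z (τ, s)) (ℓ (Ξ (t, s)) (Z (t, s)) (A (t, s))) (Icc 0 h) t)
    (hw0 : w 0 = 0)
    (hw : ∀ t ∈ Icc 0 h, HasDerivWithinAt w
      (deriv (fun y => ℓ (ξ t) y (α t)) (z t) * w t
        + (fderiv ℝ (fun x => ℓ x (z t) (α t)) (ξ t) (δξ t)
          + fderiv ℝ (fun a => ℓ (ξ t) (z t) a) (α t) (δα t))) (Icc 0 h) t) :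
    HasDerivAt (fun s => ∫ t in (0 : ℝ)..h, ℓ (Ξ (t, s)) (Z (t, s)) (A (t, s))) (w h) 0 := by
  have hF := contDiffOn_lagrangian_family hℓ hΞ hA
  have key := hasDerivAt_solution_family hh hε hF (z := z) (Z := Z) (w := w)
    (a := fun t => deriv (fun y => ℓ (ξ t) y (α t)) (z t))
    (b := fun t => fderiv ℝ (fun x => ℓ x (z t) (α t)) (ξ t) (δξ t)
          + fderiv ℝ (fun a => ℓ (ξ t) (z t) a) (α t) (δα t))
    (fun t ht => by simpa only [(h0 t ht).1, (h0 t ht).2] using hz t ht) hZ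
    (fun t ht => by
      simp only [(h0 t ht).1, (h0 t ht).2]
      exact (hasDerivAt_partial_snd hℓ _ _ _).differentiableAt.hasDerivAt)
    (fun t ht => by
      have h1 := (hℓ.differentiable (by simp) (Ξ (t, 0), z t, A (t, 0))).hasFDerivAt
      have h2 := h1.comp_hasDerivAt (f := fun s => (Ξ (t, s), z t, A (t, s))) (0 : ℝ)
        ((hδ t ht).1.prodMk ((hasDerivAt_const _ (z t)).prodMk (hδ t ht).2))
      refine HasDerivAt.congr_deriv h2 ?_
      rw [(h0 t ht).1, (h0 t ht).2, fderiv_eq_partials hℓ]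
      ring)
    hw0 hw
  -- The integrand is ∂Z/∂t, so the action is an endpoint value and no differentiation under the
  -- integral is needed.
  have hsub : ∀ᶠ s in 𝓝 (0 : ℝ), ∫ t in (0 : ℝ)..h, ℓ (Ξ (t, s)) (Z (t, s)) (A (t, s)) =
      Z (h, s) - z 0 := by
    filter_upwards [Ioo_mem_nhds (neg_lt_zero.2 hε) hε] with s hs
    have hZc : ContinuousOn (fun t => Z (t, s)) (Icc 0 h) := fun t ht =>
      ((hZ s hs).2 t ht).continuousWithinAt
    rw [← (hZ s hs).1]
    refine intervalIntegral.integral_eq_sub_of_hasDerivAt_of_le hh.le hZc (fun t ht =>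
      ((hZ s hs).2 t (Ioo_subset_Icc_self ht)).hasDerivAt (Icc_mem_nhds ht.1 ht.2)) ?_
    refine ContinuousOn.intervalIntegrable ?_
    rw [uIcc_of_le hh.le]
    have h1 : ContinuousOn (fun t => (t, s)) (Icc 0 h) := by fun_prop
    have h2 : MapsTo (fun t => (t, s)) (Icc 0 h) (Icc 0 h ×ˢ Ioo (-ε) ε) := fun t ht => ⟨ht, hs⟩
    exact hℓ.continuous.comp_continuousOn ((hΞ.continuousOn.comp h1 h2).prodMk
      (hZc.prodMk (hA.continuousOn.comp h1 h2)))
  exact (key.sub_const (z 0)).congr_of_eventuallyEq hsub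

end FirstVariation

/-! ### Left reduction of the Lagrangian and of the representation -/

section Reduction

variable {E : Type*} [NormedAddCommGroup E] [NormedSpace ℝ E]
  {G : Type*} [TopologicalSpace G] [ChartedSpace E G] [Group G]
  {X : Type*} [NormedAddCommGroup X] [NormedSpace ℝ X]

lemma tangentLift_inv_self (g : G) (v : TangentSpace 𝓘(ℝ, E) g) :
    tangentLift g⁻¹ (⟨g, v⟩ : TangentBundle 𝓘(ℝ, E) G) = ⟨(1 : G), leftTangentInv (E := E) g v⟩ := by
  have h : ∀ g' : G, g' = 1 → ∀ u : E,
      (⟨g', u⟩ : TangentBundle 𝓘(ℝ, E) G) = ⟨(1 : G), u⟩ := by rintro g' rfl u; rfl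
  exact h (g⁻¹ * g) (inv_mul_cancel g) (leftTangentInv g v)

lemma infGenerator_apply {ρ : G →* (X →L[ℝ] X)} (hρ : ContMDiff 𝓘(ℝ, E) 𝓘(ℝ, X →L[ℝ] X) ∞ ρ)
    (x : X) (η : E) : infGenerator ρ x η = infRep ρ η x := by
  have h1 : HasMFDerivAt 𝓘(ℝ, E) 𝓘(ℝ, X →L[ℝ] X) ρ 1 (infRep ρ : E →L[ℝ] (X →L[ℝ] X)) :=
    (hρ.mdifferentiable (by simp) 1).hasMFDerivAt
  have h2 := (ContinuousLinearMap.apply ℝ X x : (X →L[ℝ] X) →L[ℝ] X).hasFDerivAt (x := ρ 1)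
    |>.hasMFDerivAt.comp 1 h1
  exact congrArg (fun A : E →L[ℝ] X => A η) h2.mfderiv

/-- The bilinear map `(α, η) ↦ α ∘ ρ'_η`, that is `-ρ'*_η α`. -/
noncomputable def negInfDualRep (ρ : G →* (X →L[ℝ] X)) :
    StrongDual ℝ X →L[ℝ] E →L[ℝ] StrongDual ℝ X :=
  ((ContinuousLinearMap.compL ℝ E (X →L[ℝ] X) (StrongDual ℝ X)).flip (infRep ρ)).comp
    (ContinuousLinearMap.compL ℝ X X ℝ)

lemma negInfDualRep_apply (ρ : G →* (X →L[ℝ] X)) (α : StrongDual ℝ X) (η : E) :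
    negInfDualRep ρ α η = -infDualRep ρ η α := by
  simp [negInfDualRep, infDualRep]

lemma contDiffOn_dualRep {F : Type*} [NormedAddCommGroup F] [NormedSpace ℝ F]
    {ρ : G →* (X →L[ℝ] X)} (hρ : ContMDiff 𝓘(ℝ, E) 𝓘(ℝ, X →L[ℝ] X) ∞ ρ) (α₀ : StrongDual ℝ X)
    {S : Set F} {c : F → G} (hc : ContMDiffOn 𝓘(ℝ, F) 𝓘(ℝ, E) ∞ c S) :
    ContDiffOn ℝ ∞ (fun x => α₀.comp (ρ (c x))) S :=
  (ContinuousLinearMap.compL ℝ X X ℝ α₀).contDiff.comp_contDiffOn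
    (contMDiffOn_iff_contDiffOn.1 (hρ.comp_contMDiffOn hc))

/-- Pairing α ∘ ρ'_η with the gradient in X is the differential of f in that direction; this removes
the identification X** ≃ X from all later computations. -/
lemma momentumMap_dualGradient [FiniteDimensional ℝ X] {ρ : G →* (X →L[ℝ] X)}
    (hρ : ContMDiff 𝓘(ℝ, E) 𝓘(ℝ, X →L[ℝ] X) ∞ ρ) (f : StrongDual ℝ X → ℝ) (α : StrongDual ℝ X) :
    (momentumMap ρ (dualGradient f α) α : StrongDual ℝ E) =
      (fderiv ℝ f α).comp (negInfDualRep ρ α) := by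
  ext η
  have h1 : momentumMap ρ (dualGradient f α) α η = α (infRep ρ η (dualGradient f α)) := by
    rw [← infGenerator_apply hρ]; rfl
  rw [h1]
  exact (apply_dualGradient f α (α.comp (infRep ρ η))).trans (by simp [negInfDualRep])

/-- Apply invariance to the translation by g⁻¹, under which β becomes β ∘ ρ(g). -/
lemma lagrangian_eq_reducedLagrangian {ρ : G →* (X →L[ℝ] X)}
    {L : TangentBundle 𝓘(ℝ, E) G → ℝ → StrongDual ℝ X → ℝ}
    (hinv : ∀ (g : G) (v : TangentBundle 𝓘(ℝ, E) G) (w : ℝ) (β : StrongDual ℝ X),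
      L (tangentLift g v) w (dualRep ρ g β) = L v w β)
    (g : G) (v : TangentSpace 𝓘(ℝ, E) g) (w : ℝ) (β : StrongDual ℝ X) :
    L ⟨g, v⟩ w β = reducedLagrangian L (leftTangentInv g v) w (β.comp (ρ g)) := by
  rw [← hinv g⁻¹, tangentLift_inv_self, dualRep, inv_inv]
  rfl

variable [LieGroup 𝓘(ℝ, E) ∞ G]

/-- In the trivialization of TG based at 1, the inclusion of the fibre over 1 is the identity. -/
lemma contMDiff_tangentSpace_one :
    ContMDiff 𝓘(ℝ, E) 𝓘(ℝ, E).tangent ∞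
      (fun ξ : E => (⟨(1 : G), ξ⟩ : TangentBundle 𝓘(ℝ, E) G)) := by
  intro ξ
  rw [ModelWithCorners.tangent, Bundle.contMDiffAt_totalSpace]
  refine ⟨contMDiffAt_const, ?_⟩
  refine contMDiffAt_id.congr_of_eventuallyEq (Eventually.of_forall fun η => ?_)
  change (trivializationAt E (TangentSpace 𝓘(ℝ, E)) (1 : G) ⟨(1 : G), η⟩).2 = η
  rw [TangentBundle.trivializationAt_apply]
  exact tangentCoordChange_self (I := 𝓘(ℝ, E)) (x := (1 : G)) (z := 1) (v := η)
    (mem_extChartAt_source _)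

lemma contDiff_reducedLagrangian {L : TangentBundle 𝓘(ℝ, E) G → ℝ → StrongDual ℝ X → ℝ}
    (hL : ContMDiff (𝓘(ℝ, E).tangent.prod 𝓘(ℝ, ℝ × StrongDual ℝ X)) 𝓘(ℝ, ℝ) ∞
      (fun y : TangentBundle 𝓘(ℝ, E) G × (ℝ × StrongDual ℝ X) => L y.1 y.2.1 y.2.2)) :
    ContDiff ℝ ∞ fun y : E × ℝ × StrongDual ℝ X => reducedLagrangian L y.1 y.2.1 y.2.2 := by
  rw [← contMDiff_iff_contDiff]
  have h1 : ContMDiff 𝓘(ℝ, E × ℝ × StrongDual ℝ X) 𝓘(ℝ, E).tangent ∞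
      (fun y : E × ℝ × StrongDual ℝ X => (⟨(1 : G), y.1⟩ : TangentBundle 𝓘(ℝ, E) G)) :=
    contMDiff_tangentSpace_one.comp contDiff_fst.contMDiff
  have h2 : ContMDiff 𝓘(ℝ, E × ℝ × StrongDual ℝ X) 𝓘(ℝ, ℝ × StrongDual ℝ X) ∞
      (fun y : E × ℝ × StrongDual ℝ X => y.2) := contDiff_snd.contMDiff
  exact hL.comp (h1.prodMk h2)

lemma bodyVelocity_eq_mcForm {h : ℝ} (hh : 0 < h) {g : ℝ → G}
    (hg : ContMDiffOn 𝓘(ℝ, ℝ) 𝓘(ℝ, E) ∞ g (Icc 0 h)) {t : ℝ} (ht : t ∈ Icc 0 h) :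
    (bodyVelocity h g t : E) = mcForm (Icc 0 h) g t 1 :=
  (mcForm_apply ((hg t ht).mdifferentiableWithinAt (by simp)) (uniqueDiffOn_Icc hh t ht) 1).symm

lemma hasFDerivWithinAt_dualRep {F : Type*} [NormedAddCommGroup F] [NormedSpace ℝ F]
    {ρ : G →* (X →L[ℝ] X)} (hρ : ContMDiff 𝓘(ℝ, E) 𝓘(ℝ, X →L[ℝ] X) ∞ ρ) (α₀ : StrongDual ℝ X)
    {S : Set F} {c : F → G} (hc : ContMDiffOn 𝓘(ℝ, F) 𝓘(ℝ, E) ∞ c S) {p : F} (hp : p ∈ S)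
    (hS : UniqueDiffWithinAt ℝ S p) :
    HasFDerivWithinAt (fun x => α₀.comp (ρ (c x)))
      ((negInfDualRep ρ (α₀.comp (ρ (c p)))).comp (mcForm (E := E) S c p)) S p := by
  have h1 := hasFDerivWithinAt_rep ρ hρ hc hp hS
  refine ((ContinuousLinearMap.compL ℝ X X ℝ α₀).hasFDerivAt.comp_hasFDerivWithinAt p h1)
    |>.congr_fderiv ?_
  ext v x
  simp [negInfDualRep]

/-- The Lie bracket as a bilinear map. -/
noncomputable def adL (G : Type*) [TopologicalSpace G] [ChartedSpace E G] [Group G]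
    [FiniteDimensional ℝ E] [LieGroup 𝓘(ℝ, E) ∞ G] : E →L[ℝ] E →L[ℝ] E :=
  have : CompleteSpace E := FiniteDimensional.complete ℝ E
  have : LieGroup 𝓘(ℝ, E) (minSmoothness ℝ 3) G :=
    LieGroup.of_le (n := ∞) (by
      rw [minSmoothness_of_isRCLikeNormedField]; exact WithTop.coe_le_coe.2 (le_top (a := (3 : ℕ∞))))
  LinearMap.toContinuousLinearMap
    { toFun := ad G
      map_add' := fun ξ₁ ξ₂ => ContinuousLinearMap.ext fun η =>
        add_lie (L := GroupLieAlgebra 𝓘(ℝ, E) G) (M := GroupLieAlgebra 𝓘(ℝ, E) G) ξ₁ ξ₂ η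
      map_smul' := fun c ξ => ContinuousLinearMap.ext fun η =>
        smul_lie (R := ℝ) (L := GroupLieAlgebra 𝓘(ℝ, E) G) (M := GroupLieAlgebra 𝓘(ℝ, E) G) c ξ η }

end Reduction

/-! ### Variations of curves in the group and their trivializations -/

section Variations

variable {E : Type*} [NormedAddCommGroup E] [NormedSpace ℝ E]
  {G : Type*} [TopologicalSpace G] [ChartedSpace E G] [Group G]
  {X : Type*} [NormedAddCommGroup X] [NormedSpace ℝ X]

/-- The domain `[0, h] × (-ε, ε)` of a variation. -/
abbrev varDomain (h ε : ℝ) : Set (ℝ × ℝ) := Icc 0 h ×ˢ Ioo (-ε) ε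

lemma uniqueDiffOn_varDomain {h : ℝ} (hh : 0 < h) (ε : ℝ) : UniqueDiffOn ℝ (varDomain h ε) :=
  (uniqueDiffOn_Icc hh).prod isOpen_Ioo.uniqueDiffOn

lemma mem_closure_interior_varDomain {h ε t s : ℝ} (hh : 0 < h) (ht : t ∈ Icc 0 h)
    (hs : s ∈ Ioo (-ε) ε) : (t, s) ∈ closure (interior (varDomain h ε)) := by
  rw [interior_prod_eq, interior_Icc, isOpen_Ioo.interior_eq, closure_prod_eq,
    closure_Ioo hh.ne]
  exact ⟨ht, subset_closure hs⟩

lemma hasDerivWithinAt_comp_time {W : Type*} [NormedAddCommGroup W] [NormedSpace ℝ W]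
    {f : ℝ × ℝ → W} {f' : ℝ × ℝ →L[ℝ] W} {h ε t s : ℝ} (hs : s ∈ Ioo (-ε) ε)
    (hf : HasFDerivWithinAt f f' (varDomain h ε) (t, s)) :
    HasDerivWithinAt (fun τ => f (τ, s)) (f' (1, 0)) (Icc 0 h) t :=
  hf.comp_hasDerivWithinAt (f := fun τ => (τ, s)) t
    ((hasDerivWithinAt_id _ _).prodMk (hasDerivWithinAt_const _ _ s)) (fun _ hτ => ⟨hτ, hs⟩)

lemma hasDerivAt_comp_param {W : Type*} [NormedAddCommGroup W] [NormedSpace ℝ W]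
    {f : ℝ × ℝ → W} {f' : ℝ × ℝ →L[ℝ] W} {h ε t s : ℝ} (ht : t ∈ Icc 0 h) (hs : s ∈ Ioo (-ε) ε)
    (hf : HasFDerivWithinAt f f' (varDomain h ε) (t, s)) :
    HasDerivAt (fun σ => f (t, σ)) (f' (0, 1)) s :=
  (hf.comp_hasDerivWithinAt (f := fun σ => (t, σ)) s
    ((hasDerivWithinAt_const _ _ t).prodMk (hasDerivWithinAt_id s (Ioo (-ε) ε)))
    (fun _ hσ => ⟨ht, hσ⟩)).hasDerivAt (isOpen_Ioo.mem_nhds hs)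

lemma lagrangian_tangentCurve {ρ : G →* (X →L[ℝ] X)}
    {L : TangentBundle 𝓘(ℝ, E) G → ℝ → StrongDual ℝ X → ℝ}
    (hinv : ∀ (g : G) (v : TangentBundle 𝓘(ℝ, E) G) (w : ℝ) (β : StrongDual ℝ X),
      L (tangentLift g v) w (dualRep ρ g β) = L v w β) (g : ℝ → G) (t w : ℝ) (β : StrongDual ℝ X) :
    L (tangentCurve h g t) w β = reducedLagrangian L (bodyVelocity h g t) w (β.comp (ρ (g t))) :=
  lagrangian_eq_reducedLagrangian hinv _ _ _ _

variable [LieGroup 𝓘(ℝ, E) ∞ G] {h ε : ℝ} {c : ℝ × ℝ → G} {g : ℝ → G}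

lemma bodyVelocity_variation (hh : 0 < h) (hc : ContMDiffOn 𝓘(ℝ, ℝ × ℝ) 𝓘(ℝ, E) ∞ c (varDomain h ε))
    {t s : ℝ} (ht : t ∈ Icc 0 h) (hs : s ∈ Ioo (-ε) ε) :
    (bodyVelocity h (fun τ => c (τ, s)) t : E) = mcForm (varDomain h ε) c (t, s) (1, 0) := by
  have hι : HasFDerivWithinAt (fun τ : ℝ => (τ, s)) (ContinuousLinearMap.inl ℝ ℝ ℝ) (Icc 0 h) t :=
    (hasFDerivAt_prodMk_left t s).hasFDerivWithinAt
  have hcs : ContMDiffOn 𝓘(ℝ, ℝ) 𝓘(ℝ, E) ∞ (fun τ => c (τ, s)) (Icc 0 h) :=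
    hc.comp (f := fun τ : ℝ => (τ, s))
      (contMDiff_iff_contDiff.2 (contDiff_id.prodMk contDiff_const)).contMDiffOn
      (fun τ hτ => ⟨hτ, hs⟩)
  rw [bodyVelocity_eq_mcForm hh hcs ht, mcForm_comp hc hι.differentiableWithinAt ht
    (uniqueDiffOn_Icc hh t ht) (eventually_mem_nhdsWithin.mono fun τ hτ => ⟨⟨hτ, hs⟩, rfl⟩),
    hι.fderivWithin (uniqueDiffOn_Icc hh t ht)]
  simp

lemma contDiffOn_bodyVelocity (hh : 0 < h) (hg : ContMDiffOn 𝓘(ℝ, ℝ) 𝓘(ℝ, E) ∞ g (Icc 0 h)) :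
    ContDiffOn ℝ ∞ (bodyVelocity h g : ℝ → E) (Icc 0 h) :=
  ((contDiffOn_mcForm (E := E) hg (uniqueDiffOn_Icc hh)).clm_apply contDiffOn_const).congr
    (fun _ ht => bodyVelocity_eq_mcForm hh hg ht)

lemma bodyVelocity_congr (hh : 0 < h) {g₁ g₂ : ℝ → G}
    (h₁ : ContMDiffOn 𝓘(ℝ, ℝ) 𝓘(ℝ, E) ∞ g₁ (Icc 0 h)) (h12 : ∀ t ∈ Icc 0 h, g₁ t = g₂ t) {t : ℝ}
    (ht : t ∈ Icc 0 h) : (bodyVelocity h g₁ t : E) = bodyVelocity h g₂ t := by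
  rw [bodyVelocity_eq_mcForm hh h₁ ht, bodyVelocity_eq_mcForm hh
    (h₁.congr fun t ht => (h12 t ht).symm) ht, mcForm, mcForm,
    fderivWithin_congr (fun x hx => by rw [h12 t ht, h12 x hx]) (by rw [h12 t ht])]

/-- This is the structure equation on (∂_t, ∂_s): with ξ = ω(∂_t) and η = ω(∂_s), it reads ∂_sξ -
∂_tη = [ξ, η]. -/
lemma hasDerivAt_bodyVelocity_variation [FiniteDimensional ℝ E] (hh : 0 < h) (hε : 0 < ε)
    (hc : ContMDiffOn 𝓘(ℝ, ℝ × ℝ) 𝓘(ℝ, E) ∞ c (varDomain h ε)) {t : ℝ} (ht : t ∈ Icc 0 h) :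
    HasDerivAt (fun s => (mcForm (varDomain h ε) c (t, s) (1, 0) : E))
      (derivWithin (fun τ => (mcForm (varDomain h ε) c (τ, 0) (0, 1) : E)) (Icc 0 h) t
        + ad G (mcForm (varDomain h ε) c (t, 0) (1, 0)) (mcForm (varDomain h ε) c (t, 0) (0, 1)))
      0 := by
  have h0 : (0 : ℝ) ∈ Ioo (-ε) ε := ⟨neg_lt_zero.2 hε, hε⟩
  have hω := (((contDiffOn_mcForm (E := E) hc (uniqueDiffOn_varDomain hh ε)).differentiableOn (by simp))
    (t, 0) ⟨ht, h0⟩).hasFDerivWithinAt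
  have h1 := (hasDerivAt_comp_param ht h0 hω).clm_apply (hasDerivAt_const (0 : ℝ) ((1 : ℝ), (0 : ℝ)))
  have h2 := (hasDerivWithinAt_comp_time h0 hω).clm_apply
    (hasDerivWithinAt_const t (Icc 0 h) ((0 : ℝ), (1 : ℝ)))
  refine h1.congr_deriv ?_
  rw [h2.derivWithin (uniqueDiffOn_Icc hh t ht)]
  have h3 := structure_equation hc (uniqueDiffOn_varDomain hh ε) (p := (t, 0)) ⟨ht, h0⟩
    (mem_closure_interior_varDomain hh ht h0) (1, 0) (0, 1)
  simp only [map_zero, add_zero]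
  rw [sub_eq_iff_eq_add.1 h3]
  abel

/-- Every curve in the Lie algebra vanishing at the endpoints is the left-trivialized
variational field of a variation with fixed endpoints. -/
lemma exists_variation (hg : ContMDiffOn 𝓘(ℝ, ℝ) 𝓘(ℝ, E) ∞ g (Icc 0 h)) {η : ℝ → E}
    (hη : ContDiffOn ℝ ∞ η (Icc 0 h)) (hη0 : η 0 = 0) (hηh : η h = 0) :
    ∃ (c : ℝ × ℝ → G) (ε : ℝ), 0 < ε ∧ (∀ t, c (t, 0) = g t) ∧
      (∀ s, c (0, s) = g 0 ∧ c (h, s) = g h) ∧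
      ∀ δ, 0 < δ → δ ≤ ε → ContMDiffOn 𝓘(ℝ, ℝ × ℝ) 𝓘(ℝ, E) ∞ c (varDomain h δ) ∧
        ∀ t ∈ Icc 0 h, mcForm (varDomain h δ) c (t, 0) (0, 1) = η t := by
  set φ := extChartAt 𝓘(ℝ, E) (1 : G)
  obtain ⟨r, hr, hball⟩ := Metric.mem_nhds_iff.1 (extChartAt_target_mem_nhds (I := 𝓘(ℝ, E)) (1 : G))
  obtain ⟨M, hM⟩ := isCompact_Icc.exists_bound_of_continuousOn hη.continuousOn
  have hφ1 : φ.symm (φ 1) = 1 := extChartAt_to_inv (I := 𝓘(ℝ, E)) (1 : G)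
  have hM1 : 0 < |M| + 1 := by positivity
  have hmem : ∀ t ∈ Icc 0 h, ∀ s, |s| < r / (|M| + 1) → φ 1 + s • η t ∈ φ.target := by
    intro t ht s hs
    apply hball
    rw [mem_ball_iff_norm, add_sub_cancel_left, norm_smul, Real.norm_eq_abs]
    rw [lt_div_iff₀ hM1] at hs
    calc |s| * ‖η t‖ ≤ |s| * (|M| + 1) := by
          gcongr; exact (hM t ht).trans ((le_abs_self M).trans (by linarith))
      _ < r := hs
  -- Straight lines in the chart at 1 replace the exponential map. The width keeps s η(t) within the
  -- radius r, hence inside the chart target for all t.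
  refine ⟨fun p => g p.1 * φ.symm (φ 1 + p.2 • η p.1), r / (|M| + 1), by positivity, fun t => ?_,
    fun s => ?_, fun δ hδ hδε => ?_⟩
  · simp [hφ1]
  · simp [hη0, hηh, hφ1]
  · have hc : ContMDiffOn 𝓘(ℝ, ℝ × ℝ) 𝓘(ℝ, E) ∞
        (fun p : ℝ × ℝ => g p.1 * φ.symm (φ 1 + p.2 • η p.1)) (varDomain h δ) := by
      have h1 : ContMDiffOn 𝓘(ℝ, ℝ × ℝ) 𝓘(ℝ, E) ∞ (fun p : ℝ × ℝ => g p.1) (varDomain h δ) :=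
        hg.comp contDiff_fst.contMDiff.contMDiffOn (fun p hp => hp.1)
      have h2 : ContDiffOn ℝ ∞ (fun p : ℝ × ℝ => φ 1 + p.2 • η p.1) (varDomain h δ) :=
        contDiffOn_const.add (contDiff_snd.contDiffOn.smul
          (hη.comp contDiff_fst.contDiffOn (fun p hp => hp.1)))
      exact h1.mul ((contMDiffOn_extChartAt_symm (1 : G)).comp h2.contMDiffOn (fun p hp =>
        hmem p.1 hp.1 p.2 ((abs_lt.2 hp.2).trans_le hδε)))
    refine ⟨hc, fun t ht => ?_⟩
    have h0 : (0 : ℝ) ∈ Ioo (-δ) δ := ⟨neg_lt_zero.2 hδ, hδ⟩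
    have h1 := hasDerivAt_comp_param ht h0
      (differentiableWithinAt_logDiff hc (p := (t, 0)) ⟨ht, h0⟩).hasFDerivWithinAt
    have h2 : HasDerivAt (fun s : ℝ => φ 1 + s • η t) (η t) 0 := by
      simpa using ((hasDerivAt_id (0 : ℝ)).smul_const (η t)).const_add (φ 1)
    refine h1.unique (h2.congr_of_eventuallyEq ?_)
    filter_upwards [isOpen_Ioo.mem_nhds h0] with s hs
    simp only [zero_smul, add_zero, hφ1, mul_one, inv_mul_cancel_left]
    exact φ.right_inv (hmem t ht s ((abs_lt.2 hs).trans_le hδε))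

end Variations

/-! ### Variational principles and the momentum equations -/

section Equivalences

variable {E : Type*} [NormedAddCommGroup E] [NormedSpace ℝ E] [FiniteDimensional ℝ E]
  {G : Type*} [TopologicalSpace G] [ChartedSpace E G] [Group G] [LieGroup 𝓘(ℝ, E) ∞ G]
  {X : Type*} [NormedAddCommGroup X] [NormedSpace ℝ X]

/-- The momentum equation of the Euler-Poincaré-Herglotz system, with the momentum map written
out, together with `ż = ℓ`. -/
def MomentumEquations (ρ : G →* (X →L[ℝ] X)) (ℓ : E → ℝ → StrongDual ℝ X → ℝ) (h : ℝ)
    (ξ : ℝ → E) (z : ℝ → ℝ) (α : ℝ → StrongDual ℝ X) : Prop :=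
  ∀ t ∈ Icc 0 h,
    HasDerivWithinAt (fun τ => fderiv ℝ (fun x => ℓ x (z τ) (α τ)) (ξ τ))
      ((fderiv ℝ (fun x => ℓ x (z t) (α t)) (ξ t)).comp (ad G (ξ t))
        + (fderiv ℝ (fun a => ℓ (ξ t) (z t) a) (α t)).comp (negInfDualRep ρ (α t))
        + deriv (fun w => ℓ (ξ t) w (α t)) (z t) • fderiv ℝ (fun x => ℓ x (z t) (α t)) (ξ t))
      (Icc 0 h) t ∧
    HasDerivWithinAt z (ℓ (ξ t) (z t) (α t)) (Icc 0 h) t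

variable {ρ : G →* (X →L[ℝ] X)} {ℓ : E → ℝ → StrongDual ℝ X → ℝ} {h : ℝ}
  {L : TangentBundle 𝓘(ℝ, E) G → ℝ → StrongDual ℝ X → ℝ} {α₀ : StrongDual ℝ X}
  {g : ℝ → G} {z : ℝ → ℝ} {ξ : ℝ → E} {α : ℝ → StrongDual ℝ X}

/-- The advection equation and the initial value of α are kinematic: they hold for α = α₀ ∘ ρ(g)
along any smooth g. -/
theorem eulerPoincareHerglotzEquations_iff [FiniteDimensional ℝ X]
    (hρ : ContMDiff 𝓘(ℝ, E) 𝓘(ℝ, X →L[ℝ] X) ∞ ρ) (hh : 0 < h)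
    (hg : ContMDiffOn 𝓘(ℝ, ℝ) 𝓘(ℝ, E) ∞ g (Icc 0 h)) :
    EulerPoincareHerglotzEquations ρ ℓ h (g 0) α₀ (bodyVelocity h g) z
        (fun t => α₀.comp (ρ (g t))) ↔
      MomentumEquations ρ ℓ h (bodyVelocity h g) z (fun t => α₀.comp (ρ (g t))) := by
  have hα : ∀ t ∈ Icc 0 h, HasDerivWithinAt (fun t => α₀.comp (ρ (g t)))
      (-infDualRep ρ (bodyVelocity h g t : E) (α₀.comp (ρ (g t)))) (Icc 0 h) t := by
    intro t ht
    have := (hasFDerivWithinAt_dualRep hρ α₀ hg ht (uniqueDiffOn_Icc hh t ht)).hasDerivWithinAt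
    rwa [ContinuousLinearMap.comp_apply, ← bodyVelocity_eq_mcForm hh hg ht, negInfDualRep_apply]
      at this
  have h0 : α₀.comp (ρ (g 0)) = dualRep ρ (g 0)⁻¹ α₀ := by rw [dualRep, inv_inv]
  simp only [EulerPoincareHerglotzEquations, MomentumEquations, momentumMap_dualGradient hρ]
  constructor
  · rintro ⟨-, H⟩ t ht
    exact ⟨(H t ht).1, (H t ht).2.2⟩
  · intro H
    exact ⟨h0, fun t ht => ⟨(H t ht).1, hα t ht, (H t ht).2⟩⟩

/-- Under the momentum equation w = p(η) solves the linearized equation: the ad and ρ' terms match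
the constrained variations. Hence the first variation is p(h)(η(h)) = 0. -/
theorem reducedPrinciple_of_momentumEquations
    (hℓ : ContDiff ℝ ∞ fun y : E × ℝ × StrongDual ℝ X => ℓ y.1 y.2.1 y.2.2) (hh : 0 < h)
    (H : MomentumEquations ρ ℓ h ξ z α) : ReducedPrinciple ρ ℓ h ξ z α := by
  refine ⟨fun t ht => (H t ht).2, fun ε Ξ A Z η hε hΞ hA hη hη0 hηh h0 hδ hZ => ?_⟩
  have hw := hasDerivAt_action hℓ hh hε (fun t ht => (H t ht).2) hΞ hA h0 hδ hZ
    (w := fun t => fderiv ℝ (fun x => ℓ x (z t) (α t)) (ξ t) (η t)) (by simp [hη0])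
    (fun t ht => by
      have h1 := (H t ht).1.clm_apply ((hη.differentiableOn (by simp)) t ht).hasDerivWithinAt
      refine h1.congr_deriv ?_
      simp only [add_apply, smul_apply,
        ContinuousLinearMap.comp_apply, negInfDualRep_apply, map_add, smul_eq_mul]
      ring)
  simpa [hηh] using hw

/-- Trivializing c yields an admissible reduced variation with η = ω(∂_s) at s = 0, and the two
actions agree for every s in the parameter interval. -/
theorem herglotzPrinciple_of_reducedPrinciple (hρ : ContMDiff 𝓘(ℝ, E) 𝓘(ℝ, X →L[ℝ] X) ∞ ρ)
    (hinv : ∀ (g : G) (v : TangentBundle 𝓘(ℝ, E) G) (w : ℝ) (β : StrongDual ℝ X),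
      L (tangentLift g v) w (dualRep ρ g β) = L v w β) (hh : 0 < h)
    (hg : ContMDiffOn 𝓘(ℝ, ℝ) 𝓘(ℝ, E) ∞ g (Icc 0 h))
    (H : ReducedPrinciple ρ (reducedLagrangian L) h (bodyVelocity h g) z
      (fun t => α₀.comp (ρ (g t)))) :
    HerglotzPrinciple (fun v w => L v w α₀) h g z := by
  refine ⟨fun t ht => ?_, fun ε c Z hε hc hc0 hcE hZ => ?_⟩
  · beta_reduce
    rw [lagrangian_tangentCurve hinv]
    exact H.1 t ht
  have h0 : (0 : ℝ) ∈ Ioo (-ε) ε := ⟨neg_lt_zero.2 hε, hε⟩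
  have hU := uniqueDiffOn_varDomain hh ε
  have hω := contDiffOn_mcForm (E := E) hc hU
  have hval : ∀ t ∈ Icc 0 h, ∀ s ∈ Ioo (-ε) ε, ∀ w,
      L (tangentCurve h (fun τ => c (τ, s)) t) w α₀ = reducedLagrangian L
        (mcForm (varDomain h ε) c (t, s) (1, 0)) w (α₀.comp (ρ (c (t, s)))) := by
    intro t ht s hs w
    rw [lagrangian_tangentCurve hinv, bodyVelocity_variation hh hc ht hs]
  have hmc0 : ∀ t ∈ Icc 0 h,
      (mcForm (varDomain h ε) c (t, 0) (1, 0) : E) = bodyVelocity h g t := fun t ht => by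
    rw [← bodyVelocity_variation hh hc ht h0]
    exact (bodyVelocity_congr hh hg (fun t ht => (hc0 t ht).symm) ht).symm
  have hηE : ∀ t ∈ Icc 0 h, (∀ s ∈ Ioo (-ε) ε, c (t, s) = g t) →
      (mcForm (varDomain h ε) c (t, 0) (0, 1) : E) = 0 := by
    intro t ht hct
    have h1 := hasDerivAt_comp_param ht h0
      (differentiableWithinAt_logDiff hc (p := (t, 0)) ⟨ht, h0⟩).hasFDerivWithinAt
    refine h1.unique ((hasDerivAt_const (0 : ℝ) (extChartAt 𝓘(ℝ, E) (1 : G) 1)).congr_of_eventuallyEq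
      ?_)
    filter_upwards [isOpen_Ioo.mem_nhds h0] with s hs
    rw [hct s hs, hct 0 h0, inv_mul_cancel]
  have key := H.2 ε (fun p => mcForm (varDomain h ε) c p (1, 0)) (fun p => α₀.comp (ρ (c p))) Z
    (fun t => mcForm (varDomain h ε) c (t, 0) (0, 1)) hε (hω.clm_apply contDiffOn_const)
    (contDiffOn_dualRep hρ α₀ hc)
    ((hω.clm_apply contDiffOn_const).comp (contDiff_id.prodMk contDiff_const).contDiffOn
      (fun t ht => ⟨ht, h0⟩))
    (hηE 0 ⟨le_rfl, hh.le⟩ (fun s hs => (hcE s hs).1))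
    (hηE h ⟨hh.le, le_rfl⟩ (fun s hs => (hcE s hs).2))
    (fun t ht => ⟨hmc0 t ht, by rw [hc0 t ht]⟩)
    (fun t ht => ⟨by
      rw [← hmc0 t ht]
      exact hasDerivAt_bodyVelocity_variation hh hε hc ht, by
      have := hasDerivAt_comp_param ht h0
        (hasFDerivWithinAt_dualRep hρ α₀ hc (p := (t, 0)) ⟨ht, h0⟩ (hU _ ⟨ht, h0⟩))
      rwa [ContinuousLinearMap.comp_apply, negInfDualRep_apply, hc0 t ht] at this⟩)
    (fun s hs => ⟨(hZ s hs).1, fun t ht => by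
      rw [← hval t ht s hs]
      exact (hZ s hs).2 t ht⟩)
  refine key.congr_of_eventuallyEq ?_
  filter_upwards [isOpen_Ioo.mem_nhds h0] with s hs
  refine intervalIntegral.integral_congr fun t ht => ?_
  rw [uIcc_of_le hh.le] at ht
  exact hval t ht s hs _

/-- Realize a given η by a variation of g. Its action has derivative w(h) by the first-variation
formula and 0 by the principle; the fundamental lemma then applies. -/
theorem momentumEquations_of_herglotzPrinciple (hρ : ContMDiff 𝓘(ℝ, E) 𝓘(ℝ, X →L[ℝ] X) ∞ ρ)
    (hℓ : ContDiff ℝ ∞ fun y : E × ℝ × StrongDual ℝ X => reducedLagrangian L y.1 y.2.1 y.2.2)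
    (hinv : ∀ (g : G) (v : TangentBundle 𝓘(ℝ, E) G) (w : ℝ) (β : StrongDual ℝ X),
      L (tangentLift g v) w (dualRep ρ g β) = L v w β) (hh : 0 < h)
    (hg : ContMDiffOn 𝓘(ℝ, ℝ) 𝓘(ℝ, E) ∞ g (Icc 0 h)) (hz : ContDiffOn ℝ ∞ z (Icc 0 h))
    (H : HerglotzPrinciple (fun v w => L v w α₀) h g z) :
    MomentumEquations ρ (reducedLagrangian L) h (bodyVelocity h g) z
      (fun t => α₀.comp (ρ (g t))) := by
  set ξ : ℝ → E := bodyVelocity h g with hξdef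
  set α : ℝ → StrongDual ℝ X := fun t => α₀.comp (ρ (g t)) with hαdef
  set ℓ := reducedLagrangian L
  have hzode : ∀ t ∈ Icc 0 h, HasDerivWithinAt z (ℓ (ξ t) (z t) (α t)) (Icc 0 h) t := fun t ht => by
    have := H.1 t ht
    beta_reduce at this
    rwa [lagrangian_tangentCurve hinv] at this
  have hξ : ContDiffOn ℝ ∞ ξ (Icc 0 h) := contDiffOn_bodyVelocity hh hg
  have hα : ContDiffOn ℝ ∞ α (Icc 0 h) := contDiffOn_dualRep hρ α₀ hg
  have hD : ContDiffOn ℝ ∞ (fun t => fderiv ℝ (fun y : E × ℝ × StrongDual ℝ X =>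
      ℓ y.1 y.2.1 y.2.2) (ξ t, z t, α t)) (Icc 0 h) :=
    (hℓ.fderiv_right (m := ∞) (by simp)).comp_contDiffOn (hξ.prodMk (hz.prodMk hα))
  have hp : ContDiffOn ℝ ∞ (fun t => fderiv ℝ (fun x => ℓ x (z t) (α t)) (ξ t)) (Icc 0 h) :=
    contDiffOn_momentum hℓ hξ hz hα
  have hd : ContDiffOn ℝ ∞ (fun t => fderiv ℝ (fun a => ℓ (ξ t) (z t) a) (α t)) (Icc 0 h) :=
    (hD.clm_comp contDiffOn_const).congr fun t _ => (hasFDerivAt_partial_trd hℓ _ _ _).fderiv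
  have ha : ContDiffOn ℝ ∞ (fun t => deriv (fun w => ℓ (ξ t) w (α t)) (z t)) (Icc 0 h) :=
    (hD.clm_apply contDiffOn_const).congr fun t _ => (hasDerivAt_partial_snd hℓ _ _ _).deriv
  have had : ContDiffOn ℝ ∞ (fun t => ad G (ξ t)) (Icc 0 h) :=
    (adL (E := E) G).contDiff.comp_contDiffOn hξ
  have hneg : ContDiffOn ℝ ∞ (fun t => (negInfDualRep ρ (α t) : E →L[ℝ] StrongDual ℝ X))
      (Icc 0 h) := by
    unfold negInfDualRep
    fun_prop
  refine fun t ht => ⟨hasDerivWithinAt_momentum_of_forall_variation hh hp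
    ((hp.clm_comp had).add (hd.clm_comp hneg)) ha ?_ t ht, hzode t ht⟩
  intro η hη hη0 hηh w hw0 hw
  obtain ⟨c, ε, hε, hc0, hcE, hc⟩ := exists_variation hg hη hη0 hηh
  obtain ⟨hcs, -⟩ := hc ε hε le_rfl
  have h0 : (0 : ℝ) ∈ Ioo (-ε) ε := ⟨neg_lt_zero.2 hε, hε⟩
  -- `mcForm` is a derivative within its domain, so the identities are stated for every width: both
  -- ε and the smaller δ occur below.
  have hmc0 : ∀ δ, 0 < δ → ContMDiffOn 𝓘(ℝ, ℝ × ℝ) 𝓘(ℝ, E) ∞ c (varDomain h δ) → ∀ t ∈ Icc 0 h,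
      (mcForm (varDomain h δ) c (t, 0) (1, 0) : E) = ξ t := fun δ hδ hcδ t ht => by
    rw [← bodyVelocity_variation hh hcδ ht ⟨neg_lt_zero.2 hδ, hδ⟩]
    exact (bodyVelocity_congr hh hg (fun t ht => (hc0 t).symm) ht).symm
  have hval : ∀ δ, ContMDiffOn 𝓘(ℝ, ℝ × ℝ) 𝓘(ℝ, E) ∞ c (varDomain h δ) →
      ∀ t ∈ Icc 0 h, ∀ s ∈ Ioo (-δ) δ, ∀ w,
      L (tangentCurve h (fun τ => c (τ, s)) t) w α₀ = ℓ
        (mcForm (varDomain h δ) c (t, s) (1, 0)) w (α₀.comp (ρ (c (t, s)))) := by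
    intro δ hcδ t ht s hs w
    rw [lagrangian_tangentCurve hinv, bodyVelocity_variation hh hcδ ht hs]
  have hF := contDiffOn_lagrangian_family (h := h) (ε := ε) (ℓ := ℓ)
    (Ξ := fun p => mcForm (varDomain h ε) c p (1, 0)) (A := fun p => α₀.comp (ρ (c p))) hℓ
    ((contDiffOn_mcForm (E := E) hcs (uniqueDiffOn_varDomain hh ε)).clm_apply contDiffOn_const)
    (contDiffOn_dualRep hρ α₀ hcs)
  -- The principle only tests variations whose z-equation is solvable on all of [0, h]; this forces
  -- the passage from ε to δ.
  obtain ⟨δ, C, hδ, hδε, -, Z, hZ⟩ := exists_solution_family hh hε hF (z := z) (fun t ht => by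
    have hα0 : α t = α₀.comp (ρ (c (t, 0))) := by rw [hc0]
    have := hzode t ht
    rw [← hmc0 ε hε hcs t ht, hα0] at this
    exact this)
  obtain ⟨hcδ, hcη⟩ := hc δ hδ hδε.le
  have h0δ : (0 : ℝ) ∈ Ioo (-δ) δ := ⟨neg_lt_zero.2 hδ, hδ⟩
  have hU := uniqueDiffOn_varDomain hh δ
  have hZL : ∀ s ∈ Ioo (-δ) δ, ∀ t ∈ Icc 0 h, HasDerivWithinAt (fun τ => Z (τ, s))
      (L (tangentCurve h (fun τ => c (τ, s)) t) (Z (t, s)) α₀) (Icc 0 h) t := fun s hs t ht => by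
    rw [hval ε hcs t ht s ⟨by linarith [hs.1], by linarith [hs.2]⟩]
    exact ((hZ s hs).2 t ht).1
  have hcrit := H.2 δ c Z hδ hcδ (fun t _ => hc0 t) (fun s _ => hcE s)
    (fun s hs => ⟨(hZ s hs).1, hZL s hs⟩)
  have hact := hasDerivAt_action hℓ hh hδ hzode
    (Ξ := fun p => mcForm (varDomain h δ) c p (1, 0)) (A := fun p => α₀.comp (ρ (c p))) (Z := Z)
    (δξ := fun t => derivWithin η (Icc 0 h) t + ad G (ξ t) (η t))
    (δα := fun t => negInfDualRep ρ (α t) (η t)) (w := w)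
    ((contDiffOn_mcForm (E := E) hcδ hU).clm_apply contDiffOn_const)
    (contDiffOn_dualRep hρ α₀ hcδ)
    (fun t ht => ⟨hmc0 δ hδ hcδ t ht, by simp only [hc0, hαdef]⟩)
    (fun t ht => ⟨by
      have := hasDerivAt_bodyVelocity_variation hh hδ hcδ ht
      rwa [hmc0 δ hδ hcδ t ht, hcη t ht, derivWithin_congr hcη (hcη t ht)] at this, by
      have := hasDerivAt_comp_param ht h0δ
        (hasFDerivWithinAt_dualRep hρ α₀ hcδ (p := (t, 0)) ⟨ht, h0δ⟩ (hU _ ⟨ht, h0δ⟩))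
      rwa [ContinuousLinearMap.comp_apply, hc0 t, hcη t ht] at this⟩)
    (fun s hs => ⟨(hZ s hs).1, fun t ht => by
      rw [← hval δ hcδ t ht s hs]
      exact hZL s hs t ht⟩)
    hw0 (fun t ht => (hw t ht).congr_deriv (by
      simp only [add_apply, ContinuousLinearMap.comp_apply, map_add]
      ring))
  refine hact.unique (hcrit.congr_of_eventuallyEq ?_)
  filter_upwards [isOpen_Ioo.mem_nhds h0δ] with s hs
  refine intervalIntegral.integral_congr fun t ht => ?_
  rw [uIcc_of_le hh.le] at ht
  exact (hval δ hcδ t ht s hs _).symm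

end Equivalences

/-! ### Herglotz equations in the left trivialization and in charts -/

section LocalEquations

variable {E : Type*} [NormedAddCommGroup E] [NormedSpace ℝ E]
  {G : Type*} [TopologicalSpace G] [ChartedSpace E G] [Group G] [LieGroup 𝓘(ℝ, E) ∞ G]
  {X : Type*} [NormedAddCommGroup X] [NormedSpace ℝ X]
  {ρ : G →* (X →L[ℝ] X)} {h : ℝ}
  {L : TangentBundle 𝓘(ℝ, E) G → ℝ → StrongDual ℝ X → ℝ} {α₀ : StrongDual ℝ X}
  {g : ℝ → G} {z : ℝ → ℝ}

/-- As F(gx) = f((α₀ ∘ ρ(g)) ∘ ρ(x)), differentiating at x = 1 turns T₁*ℒ_g(δL/δg) into the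
momentum-map term. -/
lemma mfderiv_comp_leftTangent (hρ : ContMDiff 𝓘(ℝ, E) 𝓘(ℝ, X →L[ℝ] X) ∞ ρ)
    {f : StrongDual ℝ X → ℝ} (hf : Differentiable ℝ f) {α₀ : StrongDual ℝ X} {F : G → ℝ}
    (hF : ∀ x, F x = f (α₀.comp (ρ x))) (g : G) {A : TangentSpace 𝓘(ℝ, E) g →L[ℝ] ℝ}
    (hA : A = mfderiv 𝓘(ℝ, E) 𝓘(ℝ, ℝ) F g) :
    A.comp (leftTangent g) =
      (fderiv ℝ f (α₀.comp (ρ g))).comp (negInfDualRep ρ (α₀.comp (ρ g))) := by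
  obtain rfl : F = fun x => f (α₀.comp (ρ x)) := funext hF
  subst hA
  have hder : ∀ (β : StrongDual ℝ X) (y : G), HasMFDerivAt 𝓘(ℝ, E) 𝓘(ℝ, ℝ)
      (fun x : G => f (β.comp (ρ x))) y
      ((fderiv ℝ f (β.comp (ρ y))).comp ((ContinuousLinearMap.compL ℝ X X ℝ β).comp
        (mfderiv 𝓘(ℝ, E) 𝓘(ℝ, X →L[ℝ] X) ρ y))) := fun β y =>
    (hf _).hasFDerivAt.hasMFDerivAt.comp y
      ((ContinuousLinearMap.compL ℝ X X ℝ β).hasFDerivAt.hasMFDerivAt.comp y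
        (hρ.mdifferentiable (by simp) y).hasMFDerivAt)
  have h1 := (hder α₀ (g * 1)).mdifferentiableAt.hasMFDerivAt
  have h2 := h1.comp (1 : G) (hasMFDerivAt_mul_left g 1)
  have h3 : (fun x : G => f (α₀.comp (ρ x))) ∘ (fun x : G => g * x) =
      fun x => f ((α₀.comp (ρ g)).comp (ρ x)) := by
    ext x; simp [ContinuousLinearMap.mul_def, ContinuousLinearMap.comp_assoc]
  rw [h3] at h2
  have h4 := hasMFDerivAt_unique h2 (hder (α₀.comp (ρ g)) 1)
  have h5 : ∀ g' : G, g' = g → ∀ v : E,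
      (show ℝ from mfderiv 𝓘(ℝ, E) 𝓘(ℝ, ℝ) (fun x : G => f (α₀.comp (ρ x))) g' v) =
      mfderiv 𝓘(ℝ, E) 𝓘(ℝ, ℝ) (fun x : G => f (α₀.comp (ρ x))) g v := by rintro g' rfl v; rfl
  ext v
  refine (h5 (g * 1) (mul_one g) _).symm.trans ((congrArg (fun A => A v) h4).trans ?_)
  have h6 : (α₀.comp (ρ g)).comp (ρ 1) = α₀.comp (ρ g) := by rw [map_one]; rfl
  change fderiv ℝ f ((α₀.comp (ρ g)).comp (ρ 1)) ((α₀.comp (ρ g)).comp (infRep ρ v)) = _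
  rw [h6]
  rfl

theorem trivializedHerglotzEquations_iff [FiniteDimensional ℝ E]
    (hρ : ContMDiff 𝓘(ℝ, E) 𝓘(ℝ, X →L[ℝ] X) ∞ ρ)
    (hℓ : ContDiff ℝ ∞ fun y : E × ℝ × StrongDual ℝ X => reducedLagrangian L y.1 y.2.1 y.2.2)
    (hinv : ∀ (g : G) (v : TangentBundle 𝓘(ℝ, E) G) (w : ℝ) (β : StrongDual ℝ X),
      L (tangentLift g v) w (dualRep ρ g β) = L v w β) :
    TrivializedHerglotzEquations (fun v w => L v w α₀) h g z ↔
      MomentumEquations ρ (reducedLagrangian L) h (bodyVelocity h g) z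
        (fun t => α₀.comp (ρ (g t))) := by
  have hT : ∀ (x : G) (ξ : E) (w : ℝ), trivializedLagrangian (fun v w => L v w α₀) x ξ w =
      reducedLagrangian L ξ w (α₀.comp (ρ x)) := fun x ξ w => by
    rw [trivializedLagrangian, lagrangian_eq_reducedLagrangian hinv, leftTangentInv_leftTangent]
  have hv : ∀ t, velocity (E := E) h g t = leftTangent (g t) (bodyVelocity h g t) := fun t =>
    (leftTangent_leftTangentInv _ _).symm
  have hf : ∀ (ξ : E) (w : ℝ), Differentiable ℝ (fun a => reducedLagrangian L ξ w a) :=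
    fun ξ w a => (hasFDerivAt_partial_trd hℓ ξ w a).differentiableAt
  refine forall₂_congr fun t _ => ?_
  have hd := mfderiv_comp_leftTangent hρ (hf (bodyVelocity h g t) (z t)) (α₀ := α₀)
    (fun x => hT x (bodyVelocity h g t) (z t)) (g t) rfl
  dsimp only
  rw [hd]
  simp only [hT]
  exact ⟨fun H => ⟨H.1, H.2.2⟩, fun H => ⟨H.1, hv t, H.2⟩⟩

lemma chartLagrangian_eq
    (hinv : ∀ (g : G) (v : TangentBundle 𝓘(ℝ, E) G) (w : ℝ) (β : StrongDual ℝ X),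
      L (tangentLift g v) w (dualRep ρ g β) = L v w β) {e : OpenPartialHomeomorph G E}
    (he : e ∈ IsManifold.maximalAtlas 𝓘(ℝ, E) ∞ G) {q : E} (hq : q ∈ e.target) (v : E) (w : ℝ) :
    chartLagrangian (fun v w => L v w α₀) e q v w =
      reducedLagrangian L (mcForm e.target e.symm q v) w (α₀.comp (ρ (e.symm q))) := by
  rw [chartLagrangian, lagrangian_eq_reducedLagrangian hinv, mcForm_chart_apply he hq]

/-- With ξ = Λ(q)q' the chart momentum is p ∘ Λ(q). Differentiating it gives DΛ(q')u, while ∂L/∂q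
gives DΛ(u)q'; by the structure equation their difference is -ad_ξ(Λu), the source of the ad* term.
Invertibility of Λ(q) gives the converse. -/
theorem chart_momentumEquation_iff [FiniteDimensional ℝ E]
    (hρ : ContMDiff 𝓘(ℝ, E) 𝓘(ℝ, X →L[ℝ] X) ∞ ρ)
    (hℓ : ContDiff ℝ ∞ fun y : E × ℝ × StrongDual ℝ X => reducedLagrangian L y.1 y.2.1 y.2.2)
    (hinv : ∀ (g : G) (v : TangentBundle 𝓘(ℝ, E) G) (w : ℝ) (β : StrongDual ℝ X),
      L (tangentLift g v) w (dualRep ρ g β) = L v w β) (hh : 0 < h)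
    (hg : ContMDiffOn 𝓘(ℝ, ℝ) 𝓘(ℝ, E) ∞ g (Icc 0 h)) (hz : ContDiffOn ℝ ∞ z (Icc 0 h))
    {e : OpenPartialHomeomorph G E} (he : e ∈ IsManifold.maximalAtlas 𝓘(ℝ, E) ∞ G) {t : ℝ}
    (ht : t ∈ Icc 0 h) (hgt : g t ∈ e.source) {q q' : ℝ → E} (hq : q = fun τ => e (g τ))
    (hq' : q' = derivWithin q (Icc 0 h)) {ξ : ℝ → E} (hξ : ξ = bodyVelocity h g)
    {α : ℝ → StrongDual ℝ X} (hα : α = fun t => α₀.comp (ρ (g t)))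
    {ℓ : E → ℝ → StrongDual ℝ X → ℝ} (hℓL : ℓ = reducedLagrangian L)
    {ℓe : E → E → ℝ → ℝ} (hℓe : ℓe = chartLagrangian (fun v w => L v w α₀) e) :
    HasDerivWithinAt (fun τ => fderiv ℝ (fun v => ℓe (q τ) v (z τ)) (q' τ))
        (fderiv ℝ (fun x => ℓe x (q' t) (z t)) (q t)
          + deriv (fun w => ℓe (q t) (q' t) w) (z t) •
            fderiv ℝ (fun v => ℓe (q t) v (z t)) (q' t)) (Icc 0 h) t ↔
      HasDerivWithinAt (fun τ => fderiv ℝ (fun x => ℓ x (z τ) (α τ)) (ξ τ))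
        ((fderiv ℝ (fun x => ℓ x (z t) (α t)) (ξ t)).comp (ad G (ξ t))
          + (fderiv ℝ (fun a => ℓ (ξ t) (z t) a) (α t)).comp (negInfDualRep ρ (α t))
          + deriv (fun w => ℓ (ξ t) w (α t)) (z t) • fderiv ℝ (fun x => ℓ x (z t) (α t)) (ξ t))
        (Icc 0 h) t := by
  have hU := uniqueDiffOn_Icc hh
  rw [← hℓL] at hℓ
  set Λ : E → E →L[ℝ] E := mcForm e.target e.symm with hΛ
  have hLe : ∀ x ∈ e.target, ∀ v w, ℓe x v w = ℓ (Λ x v) w (α₀.comp (ρ (e.symm x))) :=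
    fun x hx v w => by rw [hℓe, chartLagrangian_eq hinv he hx, hℓL]
  have hnear : ∀ τ ∈ Icc 0 h, g τ ∈ e.source → ∀ᶠ y in 𝓝[Icc 0 h] τ, g y ∈ e.source :=
    fun τ hτ hτe =>
      (hg τ hτ).continuousWithinAt.preimage_mem_nhdsWithin (e.open_source.mem_nhds hτe)
  have hqd : ∀ τ ∈ Icc 0 h, g τ ∈ e.source → HasDerivWithinAt q (q' τ) (Icc 0 h) τ := by
    intro τ hτ hτe
    have h1 : ContMDiffWithinAt 𝓘(ℝ, ℝ) 𝓘(ℝ, E) ∞ (fun τ => e (g τ)) (Icc 0 h) τ :=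
      ContMDiffAt.comp_contMDiffWithinAt τ (contMDiffAt_of_mem_maximalAtlas he hτe) (hg τ hτ)
    rw [hq', hq]
    exact (h1.contDiffWithinAt.differentiableWithinAt (by simp)).hasDerivWithinAt
  have hqt : ∀ τ, g τ ∈ e.source → q τ ∈ e.target := fun τ hτ => by
    rw [hq]; exact e.map_source hτ
  have hαq : ∀ τ, g τ ∈ e.source → α₀.comp (ρ (e.symm (q τ))) = α τ := fun τ hτ => by
    simp only [hq, hα, e.left_inv hτ]
  have hξq : ∀ τ ∈ Icc 0 h, g τ ∈ e.source → Λ (q τ) (q' τ) = ξ τ := by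
    intro τ hτ hτe
    have h1 := mcForm_comp (c := g) (c₁ := e.symm) (f := q) (contMDiffOn_chart_symm he)
      (hqd τ hτ hτe).differentiableWithinAt hτ (hU τ hτ)
      ((hnear τ hτ hτe).mono fun y hy => ⟨hqt y hy, by simp only [hq, e.left_inv hy]⟩)
    rw [hξ, bodyVelocity_eq_mcForm hh hg hτ, h1, ContinuousLinearMap.comp_apply,
      (hqd τ hτ hτe).hasFDerivWithinAt.fderivWithin (hU τ hτ)]
    simp [hΛ]
  have hmom : ∀ τ ∈ Icc 0 h, g τ ∈ e.source → fderiv ℝ (fun v => ℓe (q τ) v (z τ)) (q' τ) =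
      (fderiv ℝ (fun x => ℓ x (z τ) (α τ)) (ξ τ)).comp (Λ (q τ)) := by
    intro τ hτ hτe
    simp only [hLe _ (hqt τ hτe), hαq τ hτe]
    rw [← hξq τ hτ hτe]
    exact ((hasFDerivAt_partial_fst hℓ _ _ _).differentiableAt.hasFDerivAt.comp (q' τ)
      (Λ (q τ)).hasFDerivAt).fderiv
  have hqT := hqt t hgt
  have hΛd : HasFDerivAt Λ (fderiv ℝ Λ (q t)) (q t) :=
    (((contDiffOn_mcForm (contMDiffOn_chart_symm he) e.open_target.uniqueDiffOn).contDiffAt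
      (e.open_target.mem_nhds hqT)).differentiableAt (by simp)).hasFDerivAt
  have hα' : HasFDerivAt (fun x => α₀.comp (ρ (e.symm x)))
      ((negInfDualRep ρ (α t)).comp (Λ (q t))) (q t) := by
    rw [← hαq t hgt]
    exact (hasFDerivWithinAt_dualRep hρ α₀ (contMDiffOn_chart_symm he) hqT
      (e.open_target.uniqueDiffWithinAt hqT)).hasFDerivAt (e.open_target.mem_nhds hqT)
  have hpos : ∀ u, fderiv ℝ (fun x => ℓe x (q' t) (z t)) (q t) u =
      fderiv ℝ (fun x => ℓ x (z t) (α t)) (ξ t) (fderiv ℝ Λ (q t) u (q' t)) +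
        fderiv ℝ (fun a => ℓ (ξ t) (z t) a) (α t) (negInfDualRep ρ (α t) (Λ (q t) u)) := by
    intro u
    have h1 := (hℓ.differentiable (by simp) (Λ (q t) (q' t), z t,
      α₀.comp (ρ (e.symm (q t))))).hasFDerivAt
    have h2 := h1.comp (f := fun x => (Λ x (q' t), z t, α₀.comp (ρ (e.symm x)))) (q t)
      ((hΛd.clm_apply (hasFDerivAt_const (q' t) (q t))).prodMk
        ((hasFDerivAt_const (z t) (q t)).prodMk hα'))
    have h3 : HasFDerivAt (fun x => ℓe x (q' t) (z t)) _ (q t) := h2.congr_of_eventuallyEq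
      (by filter_upwards [e.open_target.mem_nhds hqT] with x hx using hLe x hx _ _)
    rw [h3.fderiv, hξq t ht hgt, hαq t hgt]
    simp only [ContinuousLinearMap.comp_apply, ContinuousLinearMap.prod_apply]
    simp only [zero_apply]
    rw [fderiv_eq_partials hℓ]
    simp
  have hz' : deriv (fun w => ℓe (q t) (q' t) w) (z t) = deriv (fun w => ℓ (ξ t) w (α t)) (z t) := by
    simp only [hLe _ hqT, hαq t hgt, hξq t ht hgt]
  set p : ℝ → StrongDual ℝ E := fun τ => fderiv ℝ (fun x => ℓ x (z τ) (α τ)) (ξ τ) with hpdef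
  have hpd : HasDerivWithinAt p (derivWithin p (Icc 0 h) t) (Icc 0 h) t := by
    refine ((contDiffOn_momentum hℓ ?_ hz ?_).differentiableOn (by simp) t ht).hasDerivWithinAt
    · rw [hξ]; exact contDiffOn_bodyVelocity hh hg
    · rw [hα]; exact contDiffOn_dualRep hρ α₀ hg
  set R := (p t).comp (ad G (ξ t))
    + (fderiv ℝ (fun a => ℓ (ξ t) (z t) a) (α t)).comp (negInfDualRep ρ (α t))
    + deriv (fun w => ℓ (ξ t) w (α t)) (z t) • p t with hR
  -- Smoothness of the data makes p differentiable unconditionally, so both equations can be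
  -- compared through the residual p' - R.
  have hpc : HasDerivWithinAt (fun τ => fderiv ℝ (fun v => ℓe (q τ) v (z τ)) (q' τ))
      (fderiv ℝ (fun x => ℓe x (q' t) (z t)) (q t)
          + deriv (fun w => ℓe (q t) (q' t) w) (z t) •
            fderiv ℝ (fun v => ℓe (q t) v (z t)) (q' t)
        + (derivWithin p (Icc 0 h) t - R).comp (Λ (q t))) (Icc 0 h) t := by
    have h1 := hpd.clm_comp (hΛd.comp_hasDerivWithinAt t (hqd t ht hgt))
    have h2 := h1.congr_of_eventuallyEq (f₁ := fun τ => fderiv ℝ (fun v => ℓe (q τ) v (z τ)) (q' τ))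
      (by filter_upwards [hnear t ht hgt, self_mem_nhdsWithin] with τ hτe hτ using hmom τ hτ hτe)
      (hmom t ht hgt)
    refine h2.congr_deriv ?_
    ext u
    have hse := structure_equation_chart he hqT (q' t) u
    rw [← hΛ, hξq t ht hgt, sub_eq_iff_eq_add] at hse
    simp only [add_apply, ContinuousLinearMap.comp_apply, smul_apply, sub_apply, hpos, hz',
      hmom t ht hgt, hR, hse, map_add, map_neg, smul_eq_mul, Function.comp_apply, hpdef]
    ring
  constructor
  · intro H
    have h1 := (hU t ht).eq_deriv _ H hpc
    have h2 : (derivWithin p (Icc 0 h) t - R).comp (Λ (q t)) = 0 := by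
      rw [left_eq_add] at h1; exact h1
    have h3 : derivWithin p (Icc 0 h) t = R := by
      ext u
      obtain ⟨v, rfl⟩ := (isInvertible_mcForm_chart he hqT).surjective u
      have := congrArg (fun A => A v) h2
      exact sub_eq_zero.1 this
    rwa [h3] at hpd
  · intro H
    have h1 := (hU t ht).eq_deriv _ hpd H
    rw [h1, sub_self, ContinuousLinearMap.zero_comp, add_zero] at hpc
    exact hpc

theorem herglotzEquations_iff [FiniteDimensional ℝ E]
    (hρ : ContMDiff 𝓘(ℝ, E) 𝓘(ℝ, X →L[ℝ] X) ∞ ρ)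
    (hℓ : ContDiff ℝ ∞ fun y : E × ℝ × StrongDual ℝ X => reducedLagrangian L y.1 y.2.1 y.2.2)
    (hinv : ∀ (g : G) (v : TangentBundle 𝓘(ℝ, E) G) (w : ℝ) (β : StrongDual ℝ X),
      L (tangentLift g v) w (dualRep ρ g β) = L v w β) (hh : 0 < h)
    (hg : ContMDiffOn 𝓘(ℝ, ℝ) 𝓘(ℝ, E) ∞ g (Icc 0 h)) (hz : ContDiffOn ℝ ∞ z (Icc 0 h)) :
    HerglotzEquations (fun v w => L v w α₀) h g z ↔
      MomentumEquations ρ (reducedLagrangian L) h (bodyVelocity h g) z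
        (fun t => α₀.comp (ρ (g t))) := by
  constructor
  · rintro ⟨H1, H2⟩ t ht
    have he : chartAt E (g t) ∈ IsManifold.maximalAtlas 𝓘(ℝ, E) ∞ G :=
      IsManifold.chart_mem_maximalAtlas _
    have hs := mem_chart_source E (g t)
    refine ⟨(chart_momentumEquation_iff hρ hℓ hinv hh hg hz he ht hs rfl rfl rfl rfl rfl rfl).1
      (H1 _ he t ht hs), ?_⟩
    rw [← lagrangian_tangentCurve hinv]
    exact H2 t ht
  · intro H
    refine ⟨fun e he t ht hs => (chart_momentumEquation_iff hρ hℓ hinv hh hg hz he ht hs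
      rfl rfl rfl rfl rfl rfl).2 (H t ht).1, fun t ht => ?_⟩
    beta_reduce
    rw [lagrangian_tangentCurve hinv]
    exact (H t ht).2

end LocalEquations

end HerglotzReduction

/-! ### The equivalence theorem -/

theorem mainTheorem8
    {E : Type*} [NormedAddCommGroup E] [NormedSpace ℝ E] [FiniteDimensional ℝ E]
    {G : Type*} [TopologicalSpace G] [ChartedSpace E G] [Group G] [LieGroup 𝓘(ℝ, E) ∞ G]
    {X : Type*} [NormedAddCommGroup X] [NormedSpace ℝ X] [FiniteDimensional ℝ X]
    (ρ : G →* (X →L[ℝ] X)) (hρ : ContMDiff 𝓘(ℝ, E) 𝓘(ℝ, X →L[ℝ] X) ∞ ρ)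
    (Lext : TangentBundle 𝓘(ℝ, E) G → ℝ → StrongDual ℝ X → ℝ)
    (hL : ContMDiff (𝓘(ℝ, E).tangent.prod 𝓘(ℝ, ℝ × StrongDual ℝ X)) 𝓘(ℝ, ℝ) ∞
      (fun y : TangentBundle 𝓘(ℝ, E) G × (ℝ × StrongDual ℝ X) => Lext y.1 y.2.1 y.2.2))
    (hinv : ∀ (g : G) (v : TangentBundle 𝓘(ℝ, E) G) (w : ℝ) (β : StrongDual ℝ X),
      Lext (HerglotzReduction.tangentLift g v) w (HerglotzReduction.dualRep ρ g β) = Lext v w β)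
    (α₀ : StrongDual ℝ X) (h : ℝ) (hh : 0 < h)
    (g : ℝ → G) (hg : ContMDiffOn 𝓘(ℝ, ℝ) 𝓘(ℝ, E) ∞ g (Icc 0 h))
    (z : ℝ → ℝ) (hz : ContDiffOn ℝ ∞ z (Icc 0 h))
    (L₀ : TangentBundle 𝓘(ℝ, E) G → ℝ → ℝ) (hL₀ : ∀ v w, L₀ v w = Lext v w α₀)
    (ξ : ℝ → E) (hξ : ∀ t, ξ t = HerglotzReduction.bodyVelocity h g t)
    (α : ℝ → StrongDual ℝ X) (hα : ∀ t, α t = HerglotzReduction.dualRep ρ (g t)⁻¹ α₀) :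
    List.TFAE [
      HerglotzReduction.HerglotzPrinciple L₀ h g z,
      HerglotzReduction.HerglotzEquations L₀ h g z,
      HerglotzReduction.TrivializedHerglotzEquations L₀ h g z,
      HerglotzReduction.ReducedPrinciple ρ (HerglotzReduction.reducedLagrangian Lext) h ξ z α,
      HerglotzReduction.EulerPoincareHerglotzEquations ρ
        (HerglotzReduction.reducedLagrangian Lext) h (g 0) α₀ ξ z α] := by
  obtain rfl : L₀ = fun v w => Lext v w α₀ := funext₂ hL₀
  obtain rfl : ξ = HerglotzReduction.bodyVelocity h g := funext hξ
  obtain rfl : α = fun t => α₀.comp (ρ (g t)) := funext fun t => by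
    rw [hα, HerglotzReduction.dualRep, inv_inv]
  have hℓ := HerglotzReduction.contDiff_reducedLagrangian hL
  rw [HerglotzReduction.eulerPoincareHerglotzEquations_iff hρ hh hg,
    HerglotzReduction.herglotzEquations_iff hρ hℓ hinv hh hg hz,
    HerglotzReduction.trivializedHerglotzEquations_iff hρ hℓ hinv]
  -- After the rewriting, items 2, 3 and 5 are literally the same proposition `MomentumEquations`.
  tfae_have 2 ↔ 3 := Iff.rfl
  tfae_have 3 ↔ 5 := Iff.rfl
  tfae_have 5 → 4 := HerglotzReduction.reducedPrinciple_of_momentumEquations hℓ hh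
  tfae_have 4 → 1 := HerglotzReduction.herglotzPrinciple_of_reducedPrinciple hρ hinv hh hg
  tfae_have 1 → 5 :=
    HerglotzReduction.momentumEquations_of_herglotzPrinciple hρ hℓ hinv hh hg hz
  tfae_finish
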